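/- **Theorem 2.** There is an algorithm (a real RAM program that uses unit-cost arithmetic operations and comparisons on real numbers and has no real constants other than natural numbers) and a polynomial $p(m,n)$ such that the following holds for every polytope $P=\mathrm{conv}\{v_1,\dots,v_n\}=\{x\in\mathbb R^d \mid Ax\le b\}$, with $A\in\mathbb R^{m\times d}$ and $b\in\mathbb R^m$. Let $S\in\mathbb R^{m\times n}$, $S_{ij}=b_i-A_iv_j$, be the slack matrix associated to these (possibly redundant) descriptions of $P$. On input $S$ the algorithm halts after at most $p(m,n)$ steps and correctly determines whether $P$ is affinely equivalent to a Cartesian product $P_1\times P_2$ of two polytopes of positive dimension, that is, whether there are such $P_1$, $P_2$ and an affine map that restricts to a bijection from $P$ onto $P_1\times P_2$. In case it is, the algorithm outputs two matrices $S_1,S_2$, with at most $p(m,n)$ entries in total, such that, for some polytopes $P_1,P_2$ of positive dimension for which $P$ is affinely equivalent to $P_1\times P_2$, the matrix $S_i$ is a slack matrix of $P_i$ for $i=1,2$ (a slack matrix of a polytope is one associated, as above, to some pair of descriptions of it). -/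

import Mathlib

/-! ### Polytopes and slack matrices -/

/-- A polytope: the convex hull of finitely many points. -/
def IsPolytope {d : ℕ} (P : Set (Fin d → ℝ)) : Prop :=
  ∃ V : Set (Fin d → ℝ), V.Finite ∧ P = convexHull ℝ V

/-- `S` is a slack matrix of `P`: for some description of `P` as the convex hull of points
`v 0, …, v (n - 1)` and some description of `P` by inequalities `A x ≤ b`, the entry `S i j` is the
slack of the point `v j` in the inequality `i`. Both descriptions may be redundant. -/
def IsSlackMatrix {m n d : ℕ} (S : Matrix (Fin m) (Fin n) ℝ) (P : Set (Fin d → ℝ)) : Prop :=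
  ∃ (v : Fin n → Fin d → ℝ) (A : Matrix (Fin m) (Fin d) ℝ) (b : Fin m → ℝ),
    P = convexHull ℝ (Set.range v) ∧
    P = {x | ∀ i, (A.mulVec x) i ≤ b i} ∧
    ∀ i j, S i j = b i - (A.mulVec (v j)) i

/-- Two sets are affinely equivalent: some affine map between the ambient spaces restricts to a
bijection between them. -/
def AffinelyEquivalent {E F : Type*} [AddCommGroup E] [Module ℝ E] [AddCommGroup F] [Module ℝ F]
    (P : Set E) (Q : Set F) : Prop :=
  ∃ f : E →ᵃ[ℝ] F, Set.BijOn f P Q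

/-- `P` is affinely equivalent to the Cartesian product of the polytopes `P₁` and `P₂`, both of
positive dimension, that is, with more than one point. -/
def IsProductOf {d d₁ d₂ : ℕ} (P : Set (Fin d → ℝ)) (P₁ : Set (Fin d₁ → ℝ))
    (P₂ : Set (Fin d₂ → ℝ)) : Prop :=
  IsPolytope P₁ ∧ IsPolytope P₂ ∧ P₁.Nontrivial ∧ P₂.Nontrivial ∧
    AffinelyEquivalent P (P₁ ×ˢ P₂)

/-! ### Real RAM programs

The memory holds natural numbers (for indices and counters) in variables and in two-dimensional
arrays, and real numbers in two-dimensional arrays. A program is a finite text and refers to finitely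
many variables and arrays, each by a fixed name (a natural number). Natural numbers are only added,
subtracted and compared; real numbers are added, subtracted, multiplied, divided and compared, each
at unit cost. A real number cannot be turned into a natural number other than by comparisons, and
the only constants of a program are natural numbers. -/

namespace RealRAM

/-- The contents of the memory. -/
structure Store where
  /-- the variables that hold natural numbers -/
  var : ℕ → ℕ
  /-- the arrays of natural numbers: name, row, column -/
  nat : ℕ → ℕ → ℕ → ℕ
  /-- the arrays of real numbers: name, row, column -/
  real : ℕ → ℕ → ℕ → ℝ

namespace Store

/-- Assign `k` to the variable `x`. -/
def setVar (s : Store) (x k : ℕ) : Store :=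
  { s with var := fun x' => if x' = x then k else s.var x' }

/-- Write `k` to position `(i, j)` of the array `a` of natural numbers. -/
def setNat (s : Store) (a i j k : ℕ) : Store :=
  { s with nat := fun a' i' j' => if a' = a ∧ i' = i ∧ j' = j then k else s.nat a' i' j' }

/-- Write `r` to position `(i, j)` of the array `a` of real numbers. -/
noncomputable def setReal (s : Store) (a i j : ℕ) (r : ℝ) : Store :=
  { s with real := fun a' i' j' => if a' = a ∧ i' = i ∧ j' = j then r else s.real a' i' j' }

/-- The store at the start of a computation on the `m × n` matrix `S`: variables `0` and `1` hold
`m` and `n`, the real array `0` holds `S`, and everything else is `0`. -/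
noncomputable def input {m n : ℕ} (S : Matrix (Fin m) (Fin n) ℝ) : Store where
  var := fun x => if x = 0 then m else if x = 1 then n else 0
  nat := fun _ _ _ => 0
  real := fun a i j => if h : a = 0 ∧ i < m ∧ j < n then S ⟨i, h.2.1⟩ ⟨j, h.2.2⟩ else 0

/-- The `m × n` matrix that is stored in the real array `a`. -/
def matrix (s : Store) (a m n : ℕ) : Matrix (Fin m) (Fin n) ℝ :=
  fun i j => s.real a i j

end Store

/-- Expressions for natural numbers. -/
inductive NatExpr : Type
  | const (k : ℕ)
  | var (x : ℕ)
  | get (a : ℕ) (i j : NatExpr)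
  | add (e f : NatExpr)
  | sub (e f : NatExpr)

namespace NatExpr

/-- The value of an expression; subtraction is truncated at `0`. -/
def eval (s : Store) : NatExpr → ℕ
  | const k => k
  | var x => s.var x
  | get a i j => s.nat a (i.eval s) (j.eval s)
  | add e f => e.eval s + f.eval s
  | sub e f => e.eval s - f.eval s

/-- The number of steps that the evaluation of an expression takes. -/
def cost : NatExpr → ℕ
  | const _ => 1
  | var _ => 1
  | get _ i j => i.cost + j.cost + 1
  | add e f => e.cost + f.cost + 1
  | sub e f => e.cost + f.cost + 1

end NatExpr

/-- Expressions for real numbers. -/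
inductive RealExpr : Type
  | const (k : ℕ)
  | get (a : ℕ) (i j : NatExpr)
  | add (e f : RealExpr)
  | sub (e f : RealExpr)
  | mul (e f : RealExpr)
  | div (e f : RealExpr)

namespace RealExpr

/-- The value of an expression; a division by `0` returns `0`. -/
noncomputable def eval (s : Store) : RealExpr → ℝ
  | const k => (k : ℝ)
  | get a i j => s.real a (i.eval s) (j.eval s)
  | add e f => e.eval s + f.eval s
  | sub e f => e.eval s - f.eval s
  | mul e f => e.eval s * f.eval s
  | div e f => e.eval s / f.eval s

/-- The number of steps that the evaluation of an expression takes. -/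
def cost : RealExpr → ℕ
  | const _ => 1
  | get _ i j => i.cost + j.cost + 1
  | add e f => e.cost + f.cost + 1
  | sub e f => e.cost + f.cost + 1
  | mul e f => e.cost + f.cost + 1
  | div e f => e.cost + f.cost + 1

end RealExpr

/-- Tests. -/
inductive Test : Type
  | natEq (e f : NatExpr)
  | natLt (e f : NatExpr)
  | realEq (e f : RealExpr)
  | realLt (e f : RealExpr)
  | not (b : Test)
  | and (b c : Test)

namespace Test

/-- The test succeeds. -/
def Holds (s : Store) : Test → Prop
  | natEq e f => e.eval s = f.eval s
  | natLt e f => e.eval s < f.eval s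
  | realEq e f => e.eval s = f.eval s
  | realLt e f => e.eval s < f.eval s
  | not b => ¬ b.Holds s
  | and b c => b.Holds s ∧ c.Holds s

/-- The number of steps that a test takes. -/
def cost : Test → ℕ
  | natEq e f => e.cost + f.cost + 1
  | natLt e f => e.cost + f.cost + 1
  | realEq e f => e.cost + f.cost + 1
  | realLt e f => e.cost + f.cost + 1
  | not b => b.cost + 1
  | and b c => b.cost + c.cost + 1

end Test

/-- Programs. -/
inductive Program : Type
  | skip
  | setVar (x : ℕ) (e : NatExpr)
  | setNat (a : ℕ) (i j : NatExpr) (e : NatExpr)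
  | setReal (a : ℕ) (i j : NatExpr) (e : RealExpr)
  | seq (c₁ c₂ : Program)
  | ite (b : Test) (c₁ c₂ : Program)
  | loop (b : Test) (c : Program)

/-- `Runs c s s' t`: the program `c`, started with memory `s`, halts after exactly `t` steps with
memory `s'`. Here `loop b c` repeats `c` as long as the test `b`, made before each pass,
succeeds. -/
inductive Runs : Program → Store → Store → ℕ → Prop
  | skip (s : Store) : Runs .skip s s 1
  | setVar (s : Store) (x : ℕ) (e : NatExpr) :
      Runs (.setVar x e) s (s.setVar x (e.eval s)) (e.cost + 1)
  | setNat (s : Store) (a : ℕ) (i j : NatExpr) (e : NatExpr) :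
      Runs (.setNat a i j e) s (s.setNat a (i.eval s) (j.eval s) (e.eval s))
        (i.cost + j.cost + e.cost + 1)
  | setReal (s : Store) (a : ℕ) (i j : NatExpr) (e : RealExpr) :
      Runs (.setReal a i j e) s (s.setReal a (i.eval s) (j.eval s) (e.eval s))
        (i.cost + j.cost + e.cost + 1)
  | seq {c₁ c₂ : Program} {s s' s'' : Store} {t t' : ℕ} :
      Runs c₁ s s' t → Runs c₂ s' s'' t' → Runs (.seq c₁ c₂) s s'' (t + t')
  | iteTrue {b : Test} {c₁ c₂ : Program} {s s' : Store} {t : ℕ} :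
      b.Holds s → Runs c₁ s s' t → Runs (.ite b c₁ c₂) s s' (b.cost + t + 1)
  | iteFalse {b : Test} {c₁ c₂ : Program} {s s' : Store} {t : ℕ} :
      ¬ b.Holds s → Runs c₂ s s' t → Runs (.ite b c₁ c₂) s s' (b.cost + t + 1)
  | loopDone {b : Test} {c : Program} {s : Store} :
      ¬ b.Holds s → Runs (.loop b c) s s (b.cost + 1)
  | loopStep {b : Test} {c : Program} {s s' s'' : Store} {t t' : ℕ} :
      b.Holds s → Runs c s s' t → Runs (.loop b c) s' s'' t' →
      Runs (.loop b c) s s'' (b.cost + t + 1 + t')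

/-- Programs are deterministic: the final memory and the number of steps are determined by the
program and the initial memory. -/
theorem Runs.unique {c : Program} {s s₁ s₂ : Store} {t₁ t₂ : ℕ}
    (h₁ : Runs c s s₁ t₁) (h₂ : Runs c s s₂ t₂) : s₁ = s₂ ∧ t₁ = t₂ := by
  induction h₁ generalizing s₂ t₂ with
  | skip => cases h₂; exact ⟨rfl, rfl⟩
  | setVar => cases h₂; exact ⟨rfl, rfl⟩
  | setNat => cases h₂; exact ⟨rfl, rfl⟩
  | setReal => cases h₂; exact ⟨rfl, rfl⟩
  | seq _ _ ih ih' =>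
    cases h₂ with
    | seq k k' =>
      obtain ⟨rfl, rfl⟩ := ih k
      obtain ⟨rfl, rfl⟩ := ih' k'
      exact ⟨rfl, rfl⟩
  | iteTrue hb _ ih =>
    cases h₂ with
    | iteTrue _ k => obtain ⟨rfl, rfl⟩ := ih k; exact ⟨rfl, rfl⟩
    | iteFalse hb' _ => exact absurd hb hb'
  | iteFalse hb _ ih =>
    cases h₂ with
    | iteTrue hb' _ => exact absurd hb' hb
    | iteFalse _ k => obtain ⟨rfl, rfl⟩ := ih k; exact ⟨rfl, rfl⟩
  | loopDone hb =>
    cases h₂ with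
    | loopDone _ => exact ⟨rfl, rfl⟩
    | loopStep hb' _ _ => exact absurd hb' hb
  | loopStep hb _ _ ih ih' =>
    cases h₂ with
    | loopDone hb' => exact absurd hb hb'
    | loopStep _ k k' =>
      obtain ⟨rfl, rfl⟩ := ih k
      obtain ⟨rfl, rfl⟩ := ih' k'
      exact ⟨rfl, rfl⟩

/-- The answer that a halted computation leaves in memory: variable `0` holds `1` for "yes" and `0`
for "no". -/
def Store.answer (s : Store) : ℕ := s.var 0

/-- The first output matrix: its format is in the variables `1` and `2`, its entries in the real
array `1`. -/
def Store.output₁ (s : Store) : Matrix (Fin (s.var 1)) (Fin (s.var 2)) ℝ :=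
  s.matrix 1 (s.var 1) (s.var 2)

/-- The second output matrix: its format is in the variables `3` and `4`, its entries in the real
array `2`. -/
def Store.output₂ (s : Store) : Matrix (Fin (s.var 3)) (Fin (s.var 4)) ℝ :=
  s.matrix 2 (s.var 3) (s.var 4)

/-- The number of entries of the two output matrices. -/
def Store.outputSize (s : Store) : ℕ := s.var 1 * s.var 2 + s.var 3 * s.var 4

end RealRAM

/-! ### Affine functionals on convex hulls of finite families -/

section Weights

variable {E : Type*} [AddCommGroup E] [Module ℝ E] {n : ℕ}

/-! A nonconstant row with maximal zero set (`IsFacetRow`) plays the role of a facet. Within the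
affine hull, these rows alone describe the polytope (`mem_of_facetRows`) and separate its points
(`eq_of_facetRows`). So the facet slacks embed `P` as the nonnegative part of an affine subspace of
coordinate space, whose direction `facetSpace S` can be read off from the columns of `S`.

`P` is a product exactly when the coordinates split into `X` and its complement, each containing a
facet row, such that `facetSpace S` is the direct sum of its projections to the two blocks
(`IsSeparator`). For a product, each facet functional depends on one factor only
(`fstPart_const_or_sndPart_const`), and sorting the facets by factor gives `X`. Conversely, for a
separator, the slacks in `X` of one point can be combined with the slacks off `X` of another
(`exists_mem_of_separator`). Hence `P` is the product of its two coordinate projections, and the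
restricted columns form slack matrices of these (`exists_factor`).

No search over `X` is needed. If `Q` is the orthogonal projection matrix onto `facetSpace S`, then
`X` is a separator iff no nonzero entry of `Q` joins `X` to its complement
(`IsProjectionMatrix.isSeparator_iff`). The separators are thus the unions of connected components
of the support graph of `Q`, and `P` is a product iff the facet rows meet at least two components.
`Q` comes from Gram-Schmidt without normalization, so no square roots occur
(`IsProjectionMatrix.sup_span`); the components come from relabelling (`comp_spec`). All loops run
up to `m` or `n`, which gives the polynomial time bound (`runs_exec`). -/

theorem exists_weights_of_mem_convexHull {v : Fin n → E} {x : E}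
    (hx : x ∈ convexHull ℝ (Set.range v)) :
    ∃ w : Fin n → ℝ, (∀ j, 0 ≤ w j) ∧ ∑ j, w j = 1 ∧
      ∀ f : E →ᵃ[ℝ] ℝ, f x = ∑ j, w j * f (v j) := by
  classical
  rw [convexHull_range_eq_exists_affineCombination] at hx
  obtain ⟨t, w, hw, h1, rfl⟩ := hx
  refine ⟨fun j => if j ∈ t then w j else 0, fun j => ?_, ?_, fun f => ?_⟩
  · dsimp only
    split_ifs with h
    exacts [hw j h, le_rfl]
  · simpa using h1
  · rw [Finset.map_affineCombination _ _ _ h1, Finset.affineCombination_eq_linear_combination _ _ _ h1]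
    simp [ite_mul]

theorem exists_mem_convexHull_of_weights (v : Fin n → E) {w : Fin n → ℝ} (hw : ∀ j, 0 ≤ w j)
    (h1 : ∑ j, w j = 1) :
    ∃ x ∈ convexHull ℝ (Set.range v), ∀ f : E →ᵃ[ℝ] ℝ, f x = ∑ j, w j * f (v j) := by
  refine ⟨Finset.univ.affineCombination ℝ v w,
    affineCombination_mem_convexHull (fun j _ => hw j) h1, fun f => ?_⟩
  rw [Finset.map_affineCombination _ _ _ h1, Finset.affineCombination_eq_linear_combination _ _ _ h1]
  simp

theorem AffineMap.eq_const_on_convexHull {v : Fin n → E} {f : E →ᵃ[ℝ] ℝ} {r : ℝ}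
    (h : ∀ j, f (v j) = r) {x : E} (hx : x ∈ convexHull ℝ (Set.range v)) : f x = r := by
  obtain ⟨w, -, h1, hf⟩ := exists_weights_of_mem_convexHull hx
  rw [hf]
  simp [h, ← Finset.sum_mul, h1]

theorem AffineMap.eq_on_affineSpan {F : Type*} [AddCommGroup F] [Module ℝ F] {f g : E →ᵃ[ℝ] F}
    {s : Set E} (h : Set.EqOn f g s) {x : E} (hx : x ∈ affineSpan ℝ s) : f x = g x := by
  refine affineSpan_induction (p := fun x => f x = g x) hx h fun c u v w hu hv hw => ?_
  simp only [AffineMap.map_vadd, map_smul, AffineMap.linearMap_vsub, hu, hv, hw]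

theorem AffineMap.apply_add_smul {F : Type*} [AddCommGroup F] [Module ℝ F] (f : E →ᵃ[ℝ] F)
    (x u : E) (r : ℝ) : f (x + r • u) = f x + r • f.linear u := by
  rw [add_comm, ← vadd_eq_add, AffineMap.map_vadd, map_smul, vadd_eq_add, add_comm]

end Weights

/-! ### Facet rows of a matrix -/

section Facet

variable {m n : ℕ}

/-- The row `i` is not constant. -/
def NonconstRow (S : Matrix (Fin m) (Fin n) ℝ) (i : Fin m) : Prop :=
  ∃ j j', S i j ≠ S i j'

/-- The row `i` is not constant, and no nonconstant row vanishes on a larger set of columns. -/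
def IsFacetRow (S : Matrix (Fin m) (Fin n) ℝ) (i : Fin m) : Prop :=
  NonconstRow S i ∧ ∀ k, NonconstRow S k →
    ¬ ((∀ j, S i j = 0 → S k j = 0) ∧ ∃ j, S k j = 0 ∧ S i j ≠ 0)

/-- Among the finitely many nonconstant rows whose zero set contains that of `k`, one with the most
zeros is a facet row. -/
theorem NonconstRow.exists_isFacetRow {S : Matrix (Fin m) (Fin n) ℝ} {k : Fin m}
    (hk : NonconstRow S k) : ∃ i, IsFacetRow S i ∧ ∀ j, S k j = 0 → S i j = 0 := by
  classical
  let Z : Fin m → Finset (Fin n) := fun i => Finset.univ.filter fun j => S i j = 0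
  obtain ⟨i, hi, hmax⟩ := Finset.exists_max_image
    (Finset.univ.filter fun i => NonconstRow S i ∧ ∀ j, S k j = 0 → S i j = 0)
    (fun i => (Z i).card) ⟨k, by simp [hk]⟩
  simp only [Finset.mem_filter, Finset.mem_univ, true_and] at hi hmax
  refine ⟨i, ⟨hi.1, fun l hl hlt => ?_⟩, hi.2⟩
  refine (hmax l ⟨hl, fun j hj => hlt.1 j (hi.2 j hj)⟩).not_gt (Finset.card_lt_card ?_)
  rw [Finset.ssubset_iff_of_subset fun j => by simpa [Z] using hlt.1 j]
  simpa [Z] using hlt.2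

/-- The columns of a matrix, with the rows outside of `X` replaced by `0`. -/
noncomputable def maskedCol (S : Matrix (Fin m) (Fin n) ℝ) (X : Set (Fin m)) (j : Fin n) :
    Fin m → ℝ :=
  X.indicator fun i => S i j

/-- The direction of the affine hull of the columns of a matrix, all but its facet rows ignored. -/
noncomputable def facetSpace (S : Matrix (Fin m) (Fin n) ℝ) : Submodule ℝ (Fin m → ℝ) :=
  vectorSpan ℝ (Set.range (maskedCol S {i | IsFacetRow S i}))

/-- A set of coordinates such that the space of facet rows is the direct sum of its projections to
these and to the remaining coordinates. -/
def IsSeparator (S : Matrix (Fin m) (Fin n) ℝ) (X : Set (Fin m)) : Prop :=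
  ∀ c ∈ facetSpace S, X.indicator c ∈ facetSpace S

end Facet

/-! ### Slack maps -/

section Slack

variable {m n : ℕ} {E : Type*} [NormedAddCommGroup E] [NormedSpace ℝ E]

/-- The affine functionals `T i` describe the convex hull of the points `v j` within their affine
hull, and `S` holds their values at these points. -/
structure IsSlackMap (S : Matrix (Fin m) (Fin n) ℝ) (v : Fin n → E) (T : Fin m → E →ᵃ[ℝ] ℝ) :
    Prop where
  apply_eq : ∀ i j, T i (v j) = S i j
  nonneg : ∀ i j, 0 ≤ S i j
  mem : ∀ x ∈ affineSpan ℝ (Set.range v), (∀ i, 0 ≤ T i x) → x ∈ convexHull ℝ (Set.range v)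

namespace IsSlackMap

variable {S : Matrix (Fin m) (Fin n) ℝ} {v : Fin n → E} {T : Fin m → E →ᵃ[ℝ] ℝ}

theorem nonneg_of_mem (h : IsSlackMap S v T) (i : Fin m) {x : E}
    (hx : x ∈ convexHull ℝ (Set.range v)) : 0 ≤ T i x := by
  obtain ⟨w, hw, -, hf⟩ := exists_weights_of_mem_convexHull hx
  rw [hf]
  exact Finset.sum_nonneg fun j _ => mul_nonneg (hw j) (by rw [h.apply_eq]; exact h.nonneg i j)

/-- A functional that is constant on the points is constant on their affine hull, so a constant row
imposes no condition there. -/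
theorem nonneg_of_not_nonconstRow (h : IsSlackMap S v T) {i : Fin m} (hi : ¬ NonconstRow S i)
    {x : E} (hx : x ∈ affineSpan ℝ (Set.range v)) : 0 ≤ T i x := by
  obtain ⟨_, j, rfl⟩ : (Set.range v).Nonempty := (affineSpan_nonempty ℝ).1 ⟨x, hx⟩
  have : T i x = AffineMap.const ℝ E (S i j) x := by
    refine AffineMap.eq_on_affineSpan ?_ hx
    rintro _ ⟨j', rfl⟩
    by_contra hne
    exact hi ⟨j', j, by simpa [h.apply_eq] using hne⟩
  rw [this]
  exact h.nonneg i j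

/-- A point of the hull at which all nonconstant functionals are positive. -/
theorem exists_pos (h : IsSlackMap S v T) (hn : 0 < n) :
    ∃ y ∈ convexHull ℝ (Set.range v), ∀ i, NonconstRow S i → 0 < T i y := by
  have hn' : (0 : ℝ) < n := by exact_mod_cast hn
  -- The barycentre of all points works: a nonnegative row that averages to zero vanishes
  -- identically and hence is constant.
  obtain ⟨y, hy, hf⟩ := exists_mem_convexHull_of_weights v (w := fun _ => (n : ℝ)⁻¹)
    (fun _ => by positivity) (by simp [hn'.ne'])
  refine ⟨y, hy, fun i ⟨j, j', hj⟩ => ?_⟩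
  rw [hf]
  simp only [h.apply_eq]
  obtain ⟨l, hl⟩ : ∃ l, S i l ≠ 0 := by
    by_contra! h0
    exact hj (by rw [h0, h0])
  exact Finset.sum_pos' (fun j _ => mul_nonneg (by positivity) (h.nonneg i j))
    ⟨l, Finset.mem_univ _, mul_pos (by positivity) (lt_of_le_of_ne (h.nonneg i l) hl.symm)⟩

/-- Small perturbations of a point at which all nonconstant functionals are positive stay in the
hull. -/
theorem eventually_mem (h : IsSlackMap S v T) {y u : E} (hy : y ∈ affineSpan ℝ (Set.range v))
    (hpos : ∀ i, NonconstRow S i → 0 < T i y) (hu : u ∈ vectorSpan ℝ (Set.range v)) :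
    ∀ᶠ r : ℝ in nhds 0, y + r • u ∈ convexHull ℝ (Set.range v) := by
  have hmem : ∀ r : ℝ, y + r • u ∈ affineSpan ℝ (Set.range v) := fun r => by
    rw [add_comm, ← vadd_eq_add]
    exact vadd_mem_affineSpan_of_mem_affineSpan_of_mem_vectorSpan hy (Submodule.smul_mem _ _ hu)
  have : ∀ᶠ r : ℝ in nhds 0, ∀ i, NonconstRow S i → 0 < T i (y + r • u) := by
    refine Filter.eventually_all.2 fun i => ?_
    by_cases hi : NonconstRow S i
    · have hc : Continuous fun r : ℝ => T i (y + r • u) := by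
        simp only [AffineMap.apply_add_smul]
        fun_prop
      filter_upwards [hc.continuousAt.eventually (lt_mem_nhds (a := 0)
        (by simpa using hpos i hi))] with r hr _ using hr
    · exact Filter.Eventually.of_forall fun r hr => absurd hr hi
  filter_upwards [this] with r hr
  refine h.mem _ (hmem r) fun i => ?_
  by_cases hi : NonconstRow S i
  · exact (hr i hi).le
  · exact h.nonneg_of_not_nonconstRow hi (hmem r)

/-- The face on which an affine functional is minimal is contained in the zero set of a nonconstant
row. -/
theorem exists_row_of_face (h : IsSlackMap S v T) (a : E →ᵃ[ℝ] ℝ) {j₀ j₁ : Fin n}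
    (hmin : ∀ j, a (v j₀) ≤ a (v j)) (hne : a (v j₀) ≠ a (v j₁)) :
    ∃ k, NonconstRow S k ∧ ∀ j, a (v j) = a (v j₀) → S k j = 0 := by
  classical
  let J : Finset (Fin n) := Finset.univ.filter fun j => a (v j) = a (v j₀)
  have hJ0 : j₀ ∈ J := by simp [J]
  have hJ : (0 : ℝ) < J.card := by exact_mod_cast Finset.card_pos.2 ⟨j₀, hJ0⟩
  -- `y` is the barycentre of the points on the face; since all of its weights there are positive, a
  -- row that vanishes at `y` vanishes on the whole face.
  obtain ⟨y, hy, hf⟩ := exists_mem_convexHull_of_weights v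
    (w := fun j => if j ∈ J then (J.card : ℝ)⁻¹ else 0)
    (fun j => by split_ifs <;> positivity) (by simp [hJ.ne'])
  have hf' : ∀ f : E →ᵃ[ℝ] ℝ, f y = ∑ j ∈ J, (J.card : ℝ)⁻¹ * f (v j) := fun f => by
    rw [hf]; simp [ite_mul]
  have hay : a y = a (v j₀) := by
    rw [hf', Finset.sum_congr rfl (g := fun _ => (J.card : ℝ)⁻¹ * a (v j₀))
      fun j hj => by rw [(Finset.mem_filter.1 hj).2]]
    simp [hJ.ne']
  -- Otherwise `y` could be moved a little in the direction away from `v j₁` without leaving the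
  -- hull, and `a` would drop below its minimum.
  have key : ∃ k, NonconstRow S k ∧ ¬ 0 < T k y := by
    by_contra! hpos
    have hya := convexHull_subset_affineSpan _ hy
    have hv1 : v j₁ ∈ affineSpan ℝ (Set.range v) := subset_affineSpan _ _ ⟨j₁, rfl⟩
    have hev := h.eventually_mem hya hpos
      (vsub_mem_vectorSpan_of_mem_affineSpan_of_mem_affineSpan hya hv1)
    obtain ⟨r, hr, hr0⟩ := ((hev.filter_mono nhdsWithin_le_nhds).and
      (self_mem_nhdsWithin (s := Set.Ioi (0 : ℝ)))).exists
    obtain ⟨w, hw, hw1, hwf⟩ := exists_weights_of_mem_convexHull hr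
    have h1 : a (v j₀) ≤ a (y + r • (y -ᵥ v j₁)) := by
      rw [hwf, ← one_mul (a (v j₀)), ← hw1, Finset.sum_mul]
      exact Finset.sum_le_sum fun j _ => mul_le_mul_of_nonneg_left (hmin j) (hw j)
    rw [AffineMap.apply_add_smul, AffineMap.linearMap_vsub, hay] at h1
    have h2 : a (v j₀) < a (v j₁) := lt_of_le_of_ne (hmin j₁) hne
    simp only [vsub_eq_sub, smul_eq_mul] at h1
    have : r * (a (v j₀) - a (v j₁)) < 0 := mul_neg_of_pos_of_neg hr0 (by linarith)
    linarith
  obtain ⟨k, hk, hk0⟩ := key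
  refine ⟨k, hk, fun j hj => ?_⟩
  have hz : T k y = 0 := le_antisymm (not_lt.1 hk0) (h.nonneg_of_mem k hy)
  rw [hf', Finset.sum_eq_zero_iff_of_nonneg fun j _ => mul_nonneg (by positivity)
    (by rw [h.apply_eq]; exact h.nonneg k j)] at hz
  have := hz j (by simp [J, hj])
  rw [h.apply_eq] at this
  simpa [hJ.ne'] using this

/-- Within the affine hull, the facet rows describe the convex hull. -/
theorem mem_of_facetRows (h : IsSlackMap S v T) {x : E} (hx : x ∈ affineSpan ℝ (Set.range v))
    (hF : ∀ i, IsFacetRow S i → 0 ≤ T i x) : x ∈ convexHull ℝ (Set.range v) := by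
  classical
  obtain ⟨_, j, -⟩ : (Set.range v).Nonempty := (affineSpan_nonempty ℝ).1 ⟨x, hx⟩
  obtain ⟨y, hy, hpos⟩ := h.exists_pos j.pos
  by_contra hnot
  have hneg : ∃ k, T k x < 0 := by
    by_contra! h0
    exact hnot (h.mem x hx h0)
  have hnc : ∀ k, T k x < 0 → NonconstRow S k := fun k hk => by
    by_contra hk'
    exact hk.not_ge (h.nonneg_of_not_nonconstRow hk' hx)
  -- On the segment from `y` to `x`, the functional `T k` is a first one to reach zero among those
  -- that are negative at `x`; the minimized ratio is the parameter where this happens.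
  obtain ⟨k, hk, hmin⟩ := Finset.exists_min_image (Finset.univ.filter fun k => T k x < 0)
    (fun k => T k y / (T k y - T k x)) (by simpa [Finset.Nonempty] using hneg)
  simp only [Finset.mem_filter, Finset.mem_univ, true_and] at hk hmin
  have hky := hpos k (hnc k hk)
  set r := T k y / (T k y - T k x) with hr
  have hd : 0 < T k y - T k x := by linarith
  have hr0 : 0 < r := div_pos hky hd
  have hr1 : r < 1 := by rw [hr, div_lt_one hd]; linarith
  have hline : ∀ i, T i (AffineMap.lineMap y x r) = T i y + r * (T i x - T i y) := fun i => by
    rw [AffineMap.apply_lineMap, AffineMap.lineMap_apply]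
    simp [add_comm]
  have hz : AffineMap.lineMap y x r ∈ convexHull ℝ (Set.range v) := by
    refine h.mem _ (AffineMap.lineMap_mem r (convexHull_subset_affineSpan _ hy) hx) fun i => ?_
    rw [hline]
    have hiy := h.nonneg_of_mem i hy
    rcases lt_or_ge (T i x) 0 with hi | hi
    · have := hmin i hi
      rw [le_div_iff₀ (by linarith)] at this
      linarith
    · nlinarith
  have hzk : T k (AffineMap.lineMap y x r) = 0 := by
    rw [hline, hr]
    field_simp
    ring
  obtain ⟨i, hi, hki⟩ := (hnc k hk).exists_isFacetRow
  obtain ⟨w, hw, -, hwf⟩ := exists_weights_of_mem_convexHull hz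
  -- The weights of this boundary point are supported on zeros of row `k`, which are zeros of the
  -- facet row `i` as well. As `T i` is positive at `y`, it must be negative at `x`.
  have hzi : T i (AffineMap.lineMap y x r) = 0 := by
    rw [hwf] at hzk ⊢
    rw [Finset.sum_eq_zero_iff_of_nonneg fun j _ => mul_nonneg (hw j)
      (by rw [h.apply_eq]; exact h.nonneg k j)] at hzk
    refine Finset.sum_eq_zero fun j _ => ?_
    rcases mul_eq_zero.1 (hzk j (Finset.mem_univ _)) with h0 | h0
    · rw [h0, zero_mul]
    · rw [h.apply_eq] at h0
      rw [h.apply_eq, hki j h0, mul_zero]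
  rw [hline] at hzi
  have h1 := hpos i hi.1
  have h2 := hF i hi
  nlinarith

/-- The facet rows separate the points of the convex hull from those of the affine hull. -/
theorem eq_of_facetRows (h : IsSlackMap S v T) {x x' : E}
    (hx : x ∈ convexHull ℝ (Set.range v)) (hx' : x' ∈ affineSpan ℝ (Set.range v))
    (hF : ∀ i, IsFacetRow S i → T i x = T i x') : x = x' := by
  by_contra hne
  have hb : Bornology.IsBounded (convexHull ℝ (Set.range v)) :=
    isBounded_convexHull.2 (Set.finite_range v).isBounded
  obtain ⟨B, hB⟩ := hb.exists_norm_le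
  have hxa := convexHull_subset_affineSpan _ hx
  -- The facet functionals are constant along the line through `x` and `x'`, so the whole line lies
  -- in the hull, against boundedness.
  have hline : ∀ r : ℝ, x + r • (x' - x) ∈ convexHull ℝ (Set.range v) := fun r => by
    refine h.mem_of_facetRows ?_ fun i hi => ?_
    · rw [add_comm, ← vadd_eq_add]
      exact vadd_mem_affineSpan_of_mem_affineSpan_of_mem_vectorSpan hxa
        (Submodule.smul_mem _ _ (vsub_mem_vectorSpan_of_mem_affineSpan_of_mem_affineSpan hx' hxa))
    · rw [AffineMap.apply_add_smul, ← vsub_eq_sub, AffineMap.linearMap_vsub, hF i hi]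
      simpa [← hF i hi] using h.nonneg_of_mem i hx
  have hpos : 0 < ‖x' - x‖ := norm_pos_iff.2 (sub_ne_zero.2 (Ne.symm hne))
  -- This parameter gives a displacement of length `2 * B + 1`, while two points of norm at most `B`
  -- have distance at most `2 * B`.
  have h1 := hB _ (hline ((2 * B + 1) / ‖x' - x‖))
  have hB0 : 0 ≤ B := (norm_nonneg _).trans (hB _ hx)
  have h2 : ‖((2 * B + 1) / ‖x' - x‖) • (x' - x)‖ = 2 * B + 1 := by
    rw [norm_smul, Real.norm_of_nonneg (by positivity)]
    field_simp
  have h3 := norm_sub_le (x + ((2 * B + 1) / ‖x' - x‖) • (x' - x)) x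
  rw [add_sub_cancel_left, h2] at h3
  linarith [hB _ hx]

end IsSlackMap

end Slack

/-! ### Facet functionals and the space of facet slacks -/

section Product

variable {m n : ℕ} {E : Type*} [NormedAddCommGroup E] [NormedSpace ℝ E]

open Classical in
/-- The functionals of the facet rows. -/
noncomputable def facetMap (S : Matrix (Fin m) (Fin n) ℝ) (T : Fin m → E →ᵃ[ℝ] ℝ) :
    E →ᵃ[ℝ] (Fin m → ℝ) :=
  AffineMap.pi fun i => if IsFacetRow S i then T i else 0

namespace IsSlackMap

variable {S : Matrix (Fin m) (Fin n) ℝ} {v : Fin n → E} {T : Fin m → E →ᵃ[ℝ] ℝ}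

theorem facetMap_of_pos {i : Fin m} (hi : IsFacetRow S i) (x : E) :
    facetMap S T x i = T i x := by
  simp [facetMap, hi]

theorem facetMap_of_neg {i : Fin m} (hi : ¬ IsFacetRow S i) (x : E) :
    facetMap S T x i = 0 := by
  simp [facetMap, hi]

theorem facetMap_apply (h : IsSlackMap S v T) (j : Fin n) :
    facetMap S T (v j) = maskedCol S {i | IsFacetRow S i} j := by
  ext i
  by_cases hi : IsFacetRow S i
  · simp [facetMap_of_pos hi, maskedCol, hi, h.apply_eq]
  · simp [facetMap_of_neg hi, maskedCol, hi]

theorem facetSpace_eq (h : IsSlackMap S v T) :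
    facetSpace S = (vectorSpan ℝ (Set.range v)).map (facetMap S T).linear := by
  rw [AffineMap.map_vectorSpan, facetSpace, ← Set.range_comp]
  congr 2
  ext1 j
  exact (h.facetMap_apply j).symm

theorem sub_mem_facetSpace (h : IsSlackMap S v T) {x x' : E}
    (hx : x ∈ affineSpan ℝ (Set.range v)) (hx' : x' ∈ affineSpan ℝ (Set.range v)) :
    facetMap S T x - facetMap S T x' ∈ facetSpace S := by
  rw [h.facetSpace_eq, ← vsub_eq_sub, ← AffineMap.linearMap_vsub]
  exact Submodule.mem_map_of_mem (vsub_mem_vectorSpan_of_mem_affineSpan_of_mem_affineSpan hx hx')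

end IsSlackMap

theorem IsSeparator.compl {S : Matrix (Fin m) (Fin n) ℝ} {X : Set (Fin m)} (hX : IsSeparator S X) :
    IsSeparator S Xᶜ := fun c hc => by
  rw [Set.indicator_compl]
  exact Submodule.sub_mem _ hc (hX c hc)

/-! ### The facet rows of a Cartesian product -/

namespace IsSlackMap

variable {E₁ E₂ : Type*} [NormedAddCommGroup E₁] [NormedSpace ℝ E₁] [NormedAddCommGroup E₂]
  [NormedSpace ℝ E₂] {S : Matrix (Fin m) (Fin n) ℝ} {v : Fin n → E₁ × E₂}
  {T : Fin m → E₁ × E₂ →ᵃ[ℝ] ℝ} {Q₁ : Set E₁} {Q₂ : Set E₂}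

/-- An affine functional on a product, restricted to the first factor. -/
noncomputable def fstPart (f : E₁ × E₂ →ᵃ[ℝ] ℝ) : E₁ × E₂ →ᵃ[ℝ] ℝ :=
  (f.linear ∘ₗ LinearMap.inl ℝ E₁ E₂ ∘ₗ LinearMap.fst ℝ E₁ E₂).toAffineMap

/-- An affine functional on a product, restricted to the second factor. -/
noncomputable def sndPart (f : E₁ × E₂ →ᵃ[ℝ] ℝ) : E₁ × E₂ →ᵃ[ℝ] ℝ :=
  (f.linear ∘ₗ LinearMap.inr ℝ E₁ E₂ ∘ₗ LinearMap.snd ℝ E₁ E₂).toAffineMap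

theorem eq_fstPart_add_sndPart (f : E₁ × E₂ →ᵃ[ℝ] ℝ) (x : E₁ × E₂) :
    f x = fstPart f x + sndPart f x + f 0 := by
  have : f x = f.linear x + f 0 := by
    conv_lhs => rw [f.decomp]
    rfl
  rw [this]
  simp [fstPart, sndPart, ← map_add]

theorem fstPart_congr (f : E₁ × E₂ →ᵃ[ℝ] ℝ) {x y : E₁ × E₂} (h : x.1 = y.1) :
    fstPart f x = fstPart f y := by
  simp [fstPart, h]

theorem sndPart_congr (f : E₁ × E₂ →ᵃ[ℝ] ℝ) {x y : E₁ × E₂} (h : x.2 = y.2) :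
    sndPart f x = sndPart f y := by
  simp [sndPart, h]

/-- If both parts `a` and `b` of a facet functional varied, its zero set would lie properly inside
the face where `a` is minimal. That face is contained in the zero set of a nonconstant row, which
contradicts the maximality of the zero set of the facet row. -/
theorem fstPart_const_or_sndPart_const (h : IsSlackMap S v T)
    (hQ : convexHull ℝ (Set.range v) = Q₁ ×ˢ Q₂) {i : Fin m} (hi : IsFacetRow S i) :
    (∀ j j', fstPart (T i) (v j) = fstPart (T i) (v j')) ∨
      ∀ j j', sndPart (T i) (v j) = sndPart (T i) (v j') := by
  have hmix : ∀ j j', ((v j).1, (v j').2) ∈ convexHull ℝ (Set.range v) := fun j j' => by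
    have h1 := subset_convexHull ℝ _ (Set.mem_range_self (f := v) j)
    have h2 := subset_convexHull ℝ _ (Set.mem_range_self (f := v) j')
    rw [hQ] at h1 h2 ⊢
    exact ⟨h1.1, h2.2⟩
  by_contra! hcon
  obtain ⟨⟨j₁, j₂, hj⟩, l₁, l₂, hl⟩ := hcon
  set a := fstPart (T i)
  set b := sndPart (T i)
  have hac : ∀ {x y : E₁ × E₂}, x.1 = y.1 → a x = a y := fun h0 => fstPart_congr (T i) h0
  have hbc : ∀ {x y : E₁ × E₂}, x.2 = y.2 → b x = b y := fun h0 => sndPart_congr (T i) h0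
  have hT : ∀ x, T i x = a x + b x + T i 0 := eq_fstPart_add_sndPart (T i)
  have hmixT : ∀ j j', 0 ≤ a (v j) + b (v j') + T i 0 := fun j j' => by
    have := h.nonneg_of_mem i (hmix j j')
    rwa [hT, hac (x := ((v j).1, (v j').2)) (y := v j) rfl,
      hbc (x := ((v j).1, (v j').2)) (y := v j') rfl] at this
  obtain ⟨j₀, -, hmin⟩ := Finset.exists_min_image Finset.univ (fun j => a (v j)) ⟨j₁, by simp⟩
  replace hmin : ∀ j, a (v j₀) ≤ a (v j) := fun j => hmin j (Finset.mem_univ j)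
  have hne : ∃ j, a (v j₀) ≠ a (v j) := by
    by_contra! h0
    exact hj ((h0 _).symm.trans (h0 _))
  obtain ⟨j₃, hj₃⟩ := hne
  obtain ⟨k, hk, hkz⟩ := h.exists_row_of_face a hmin hj₃
  refine hi.2 k hk ⟨fun j hij => hkz j (le_antisymm ?_ (hmin j)), ?_⟩
  -- At a zero of row `i`, replacing the first component by that of `v j₀` keeps the functional
  -- nonnegative, so `a` is already minimal there.
  · have h1 := hmixT j₀ j
    rw [← h.apply_eq, hT] at hij
    linarith
  -- If the inclusion were not proper, row `i` would vanish on the whole face, making `b` constant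
  -- on it. But the face still projects onto the whole second factor, so `b` would be constant
  -- everywhere.
  · by_contra! hall
    have hface : ∀ j, a (v j) = a (v j₀) → b (v j) = -(a (v j₀) + T i 0) := fun j hja => by
      have := hall j (hkz j hja)
      rw [← h.apply_eq, hT, hja] at this
      linarith
    obtain ⟨l, hl⟩ : ∃ l, b (v l) ≠ -(a (v j₀) + T i 0) := by
      by_contra! h0
      exact hl ((h0 _).trans (h0 _).symm)
    -- This mixed point minimizes `a`, so its weights are supported on the points that minimize `a`.
    obtain ⟨w, hw, hw1, hwf⟩ := exists_weights_of_mem_convexHull (hmix j₀ l)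
    have ha := hwf a
    have hb := hwf b
    rw [hac (x := ((v j₀).1, (v l).2)) (y := v j₀) rfl] at ha
    rw [hbc (x := ((v j₀).1, (v l).2)) (y := v l) rfl] at hb
    have hz : ∑ j, w j * (a (v j) - a (v j₀)) = 0 := by
      simp only [mul_sub, Finset.sum_sub_distrib, ← Finset.sum_mul, hw1]
      linarith
    rw [Finset.sum_eq_zero_iff_of_nonneg fun j _ => mul_nonneg (hw j) (sub_nonneg.2 (hmin j))] at hz
    refine hl (hb.trans ?_)
    rw [Finset.sum_congr rfl (g := fun j => w j * -(a (v j₀) + T i 0)), ← Finset.sum_mul, hw1,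
      one_mul]
    intro j _
    rcases mul_eq_zero.1 (hz j (Finset.mem_univ j)) with h0 | h0
    · simp [h0]
    · rw [hface j (sub_eq_zero.1 h0)]

/-- The facet rows of a Cartesian product split into those of the two factors. -/
theorem exists_separator_of_prod (h : IsSlackMap S v T)
    (hQ : convexHull ℝ (Set.range v) = Q₁ ×ˢ Q₂) (h₁ : Q₁.Nontrivial) (h₂ : Q₂.Nontrivial) :
    ∃ X : Set (Fin m), IsSeparator S X ∧ (∃ i ∈ X, IsFacetRow S i) ∧ ∃ i ∉ X, IsFacetRow S i := by
  have haff : ∀ {x}, x ∈ convexHull ℝ (Set.range v) → x ∈ affineSpan ℝ (Set.range v) :=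
    fun hx => convexHull_subset_affineSpan _ hx
  have hmem : ∀ j, v j ∈ convexHull ℝ (Set.range v) := fun j =>
    subset_convexHull ℝ _ (Set.mem_range_self (f := v) j)
  refine ⟨{i | ∀ j j', sndPart (T i) (v j) = sndPart (T i) (v j')}, ?_, ?_, ?_⟩
  · intro c hc
    rw [facetSpace, vectorSpan_def] at hc
    induction hc using Submodule.span_induction with
    | mem c hc =>
      obtain ⟨_, ⟨j, rfl⟩, _, ⟨j', rfl⟩, rfl⟩ := hc
      -- Passing from `v j'` to this mixed point changes only the first component: functionals in
      -- `X` see the full difference of columns `j` and `j'`, the other facet functionals see none.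
      -- The masked difference is therefore again a difference of facet slacks.
      have hmix : ((v j).1, (v j').2) ∈ convexHull ℝ (Set.range v) := by
        have h1 := hmem j
        have h2 := hmem j'
        rw [hQ] at h1 h2 ⊢
        exact ⟨h1.1, h2.2⟩
      convert h.sub_mem_facetSpace (haff hmix) (haff (hmem j')) using 1
      ext i
      by_cases hi : IsFacetRow S i
      · rw [Pi.sub_apply, facetMap_of_pos hi, facetMap_of_pos hi,
          eq_fstPart_add_sndPart _ (_, _), eq_fstPart_add_sndPart _ (v j'),
          fstPart_congr (T i) (x := ((v j).1, (v j').2)) (y := v j) rfl,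
          sndPart_congr (T i) (x := ((v j).1, (v j').2)) (y := v j') rfl]
        by_cases hX : ∀ j j', sndPart (T i) (v j) = sndPart (T i) (v j')
        · rw [Set.indicator_of_mem (by exact hX)]
          simp only [maskedCol, vsub_eq_sub, Pi.sub_apply]
          rw [Set.indicator_of_mem (by exact hi), Set.indicator_of_mem (by exact hi),
            ← h.apply_eq, ← h.apply_eq, eq_fstPart_add_sndPart _ (v j),
            eq_fstPart_add_sndPart _ (v j'), hX j j']
        · rw [Set.indicator_of_notMem (by exact hX)]
          have := (h.fstPart_const_or_sndPart_const hQ hi).resolve_right hX j j'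
          rw [this, sub_self]
      · rw [Pi.sub_apply, facetMap_of_neg hi, facetMap_of_neg hi, Set.indicator_apply]
        simp [maskedCol, hi]
    | zero => simp
    | add c c' _ _ hc hc' => 
      exact (Set.indicator_add _ c c').symm ▸ Submodule.add_mem _ hc hc'
    | smul r c _ hc =>
      exact (Set.indicator_const_smul _ r c).symm ▸ Submodule.smul_mem _ r hc
  · by_contra! hnone
    obtain ⟨p, hp, p', hp', hne⟩ := h₁
    obtain ⟨q, hq⟩ := h₂.nonempty
    have h1 : (p, q) ∈ convexHull ℝ (Set.range v) := by rw [hQ]; exact ⟨hp, hq⟩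
    have h2 : (p', q) ∈ convexHull ℝ (Set.range v) := by rw [hQ]; exact ⟨hp', hq⟩
    -- If no facet functional depended on the first factor alone, all of them would be blind to it,
    -- yet they separate points.
    refine hne (congrArg Prod.fst (h.eq_of_facetRows h1 (haff h2) fun i hi => ?_))
    have hc := (h.fstPart_const_or_sndPart_const hQ hi).resolve_right
      fun h0 => hnone i h0 hi
    obtain ⟨_, j, rfl⟩ := (convexHull_nonempty_iff (𝕜 := ℝ)).1 ⟨_, h1⟩
    rw [eq_fstPart_add_sndPart, eq_fstPart_add_sndPart (T i) (p', q),
      AffineMap.eq_const_on_convexHull (fun l => hc l j) h1,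
      AffineMap.eq_const_on_convexHull (fun l => hc l j) h2,
      sndPart_congr (T i) (x := (p, q)) (y := (p', q)) rfl]
  · by_contra! hnone
    obtain ⟨q, hq, q', hq', hne⟩ := h₂
    obtain ⟨p, hp⟩ := h₁.nonempty
    have h1 : (p, q) ∈ convexHull ℝ (Set.range v) := by rw [hQ]; exact ⟨hp, hq⟩
    have h2 : (p, q') ∈ convexHull ℝ (Set.range v) := by rw [hQ]; exact ⟨hp, hq'⟩
    refine hne (congrArg Prod.snd (h.eq_of_facetRows h1 (haff h2) fun i hi => ?_))
    have hc : ∀ j j', sndPart (T i) (v j) = sndPart (T i) (v j') := by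
      by_contra h0
      exact hnone i h0 hi
    obtain ⟨_, j, rfl⟩ := (convexHull_nonempty_iff (𝕜 := ℝ)).1 ⟨_, h1⟩
    rw [eq_fstPart_add_sndPart, eq_fstPart_add_sndPart (T i) (p, q'),
      AffineMap.eq_const_on_convexHull (fun l => hc l j) h1,
      AffineMap.eq_const_on_convexHull (fun l => hc l j) h2,
      fstPart_congr (T i) (x := (p, q)) (y := (p, q')) rfl]

end IsSlackMap

end Product

/-! ### Slack matrices and slack maps -/

section Transfer

variable {m n d : ℕ} {S : Matrix (Fin m) (Fin n) ℝ} {P : Set (Fin d → ℝ)}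

/-- A slack map requires the inequalities to cut out the hull only within the affine hull. In this
weaker form the notion can be carried along affine maps that are injective on the polytope but not
surjective onto the ambient space. -/
theorem IsSlackMatrix.exists_isSlackMap (h : IsSlackMatrix S P) :
    ∃ (v : Fin n → Fin d → ℝ) (T : Fin m → (Fin d → ℝ) →ᵃ[ℝ] ℝ),
      P = convexHull ℝ (Set.range v) ∧ IsSlackMap S v T := by
  obtain ⟨v, A, b, hv, hA, hS⟩ := h
  let T : Fin m → (Fin d → ℝ) →ᵃ[ℝ] ℝ := fun i =>
    AffineMap.const ℝ (Fin d → ℝ) (b i) - (LinearMap.proj i ∘ₗ A.mulVecLin).toAffineMap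
  have hT : ∀ i x, T i x = b i - (A.mulVec x) i := fun i x => rfl
  have hP : ∀ x, x ∈ convexHull ℝ (Set.range v) ↔ ∀ i, 0 ≤ T i x := fun x => by
    rw [← hv, hA]
    simp [hT]
  refine ⟨v, T, hv, fun i j => ?_, fun i j => ?_, fun x _ hx => (hP x).2 hx⟩
  · rw [hT, hS]
  · rw [hS, ← hT]
    exact (hP _).1 (subset_convexHull ℝ _ ⟨j, rfl⟩) i

variable {E F : Type*} [NormedAddCommGroup E] [NormedSpace ℝ E] [NormedAddCommGroup F]
  [NormedSpace ℝ F] {v : Fin n → E} {T : Fin m → E →ᵃ[ℝ] ℝ}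

/-- An affine map that is injective on the convex hull has an affine left inverse there. -/
theorem IsSlackMap.exists_leftInverse (h : IsSlackMap S v T) (f : E →ᵃ[ℝ] F)
    (hf : Set.InjOn f (convexHull ℝ (Set.range v))) : ∃ g : F →ᵃ[ℝ] E, ∀ j, g (f (v j)) = v j := by
  rcases n.eq_zero_or_pos with rfl | hn
  · exact ⟨AffineMap.const ℝ F 0, fun j => j.elim0⟩
  obtain ⟨y, hy, hpos⟩ := h.exists_pos hn
  have hya := convexHull_subset_affineSpan _ hy
  -- A direction killed by `f` could be followed for a short while from the relatively interior
  -- point `y` inside the hull, where `f` is injective.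
  have hker : LinearMap.ker (f.linear ∘ₗ (vectorSpan ℝ (Set.range v)).subtype) = ⊥ := by
    rw [LinearMap.ker_eq_bot']
    intro u hu
    obtain ⟨r, hr, hr0⟩ := (((h.eventually_mem hya hpos u.2).filter_mono nhdsWithin_le_nhds).and
      (self_mem_nhdsWithin (s := Set.Ioi (0 : ℝ)))).exists
    have : y + r • (u : E) = y := hf hr hy (by
      rw [AffineMap.apply_add_smul, show f.linear u = 0 from hu, smul_zero, add_zero])
    have h0 : r • (u : E) = 0 := by simpa using this
    exact Subtype.ext ((smul_eq_zero.1 h0).resolve_left (ne_of_gt hr0))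
  obtain ⟨g, hg⟩ := LinearMap.exists_leftInverse_of_injective _ hker
  refine ⟨((vectorSpan ℝ (Set.range v)).subtype ∘ₗ g).toAffineMap.comp
    (AffineMap.id ℝ F - AffineMap.const ℝ F (f y)) + AffineMap.const ℝ F y, fun j => ?_⟩
  let u : vectorSpan ℝ (Set.range v) := ⟨v j -ᵥ y,
    vsub_mem_vectorSpan_of_mem_affineSpan_of_mem_affineSpan (subset_affineSpan _ _ ⟨j, rfl⟩) hya⟩
  have h1 : g (f (v j) - f y) = u := by
    rw [← vsub_eq_sub, ← AffineMap.linearMap_vsub]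
    exact LinearMap.congr_fun hg u
  simp [h1, u]

/-- Slack maps are carried along by affine maps that are injective on the convex hull. -/
theorem IsSlackMap.image (h : IsSlackMap S v T) (f : E →ᵃ[ℝ] F)
    (hf : Set.InjOn f (convexHull ℝ (Set.range v))) :
    ∃ T' : Fin m → F →ᵃ[ℝ] ℝ, IsSlackMap S (f ∘ v) T' := by
  obtain ⟨g, hg⟩ := h.exists_leftInverse f hf
  refine ⟨fun i => (T i).comp g, fun i j => ?_, h.nonneg, fun x hx hpos => ?_⟩
  · simp [hg, h.apply_eq]
  · have hfg : f (g x) = x := by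
      refine AffineMap.eq_on_affineSpan (f := f.comp g) (g := AffineMap.id ℝ F) ?_ hx
      rintro _ ⟨j, rfl⟩
      simp [hg]
    have hgx : g x ∈ affineSpan ℝ (Set.range v) := by
      have : g x ∈ (affineSpan ℝ (Set.range (f ∘ v))).map g := ⟨x, hx, rfl⟩
      rwa [AffineSubspace.map_span, ← Set.range_comp, show g ∘ f ∘ v = v from funext hg] at this
    rw [Set.range_comp, ← AffineMap.image_convexHull]
    exact ⟨g x, h.mem _ hgx hpos, hfg⟩

theorem IsSlackMatrix.exists_separator (h : IsSlackMatrix S P)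
    (hP : ∃ (d₁ d₂ : ℕ) (P₁ : Set (Fin d₁ → ℝ)) (P₂ : Set (Fin d₂ → ℝ)), IsProductOf P P₁ P₂) :
    ∃ X : Set (Fin m), IsSeparator S X ∧ (∃ i ∈ X, IsFacetRow S i) ∧ ∃ i ∉ X, IsFacetRow S i := by
  obtain ⟨d₁, d₂, P₁, P₂, -, -, h₁, h₂, f, hf⟩ := hP
  obtain ⟨v, T, rfl, hT⟩ := h.exists_isSlackMap
  obtain ⟨T', hT'⟩ := hT.image f hf.injOn
  refine hT'.exists_separator_of_prod (Q₁ := P₁) (Q₂ := P₂) ?_ h₁ h₂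
  rw [← hf.image_eq, AffineMap.image_convexHull, Set.range_comp]

end Transfer

/-! ### Realization of slack maps by slack matrices -/

section Realization

variable {m n : ℕ}

/-- The projection that replaces the coordinates outside of `X` by `0`. -/
noncomputable def indicatorLinear (X : Set (Fin m)) : (Fin m → ℝ) →ₗ[ℝ] (Fin m → ℝ) where
  toFun := X.indicator
  map_add' c c' := Set.indicator_add X c c'
  map_smul' r c := Set.indicator_const_smul X r c

@[simp]
theorem indicatorLinear_apply (X : Set (Fin m)) (c : Fin m → ℝ) :
    indicatorLinear X c = X.indicator c := rfl

/-- If the nonnegative points of the affine hull of the columns `w j` are in their convex hull, the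
matrix of these columns is a slack matrix of their convex hull in suitable coordinates. -/
theorem exists_isSlackMatrix_of_columns (w : Fin n → Fin m → ℝ) (hn : 0 < n)
    (hpos : ∀ j i, 0 ≤ w j i)
    (hw : ∀ x ∈ affineSpan ℝ (Set.range w), (∀ i, 0 ≤ x i) → x ∈ convexHull ℝ (Set.range w)) :
    ∃ (d : ℕ) (P : Set (Fin d → ℝ)) (f : (Fin m → ℝ) →ᵃ[ℝ] (Fin d → ℝ)),
      IsSlackMatrix (Matrix.of fun i j => w j i) P ∧ IsPolytope P ∧
        Set.BijOn f (convexHull ℝ (Set.range w)) P := by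
  let V := vectorSpan ℝ (Set.range w)
  let o := w ⟨0, hn⟩
  have ho : o ∈ affineSpan ℝ (Set.range w) := subset_affineSpan _ _ ⟨_, rfl⟩
  let e : V ≃ₗ[ℝ] (Fin (Module.finrank ℝ V) → ℝ) := (Module.finBasis ℝ V).equivFun
  obtain ⟨p, hp⟩ := LinearMap.exists_leftInverse_of_injective V.subtype V.ker_subtype
  let ψ : (Fin m → ℝ) →ᵃ[ℝ] (Fin (Module.finrank ℝ V) → ℝ) :=
    (e.toLinearMap ∘ₗ p).toAffineMap.comp (AffineMap.id ℝ _ - AffineMap.const ℝ _ o)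
  let L : (Fin (Module.finrank ℝ V) → ℝ) →ₗ[ℝ] (Fin m → ℝ) := V.subtype ∘ₗ e.symm.toLinearMap
  have hψ : ∀ x, ψ x = e (p (x - o)) := fun x => by simp [ψ]
  have hL : ∀ y, L y = (e.symm y : Fin m → ℝ) := fun y => rfl
  have hpV : ∀ u : V, p u = u := fun u => LinearMap.congr_fun hp u
  have hψL : ∀ y, ψ (L y + o) = y := fun y => by
    rw [hψ, add_sub_cancel_right, hL, hpV, e.apply_symm_apply]
  have hLψ : ∀ x ∈ affineSpan ℝ (Set.range w), L (ψ x) + o = x := fun x hx => by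
    have h1 : x - o ∈ V := vsub_mem_vectorSpan_of_mem_affineSpan_of_mem_affineSpan hx ho
    have h2 := hpV ⟨x - o, h1⟩
    rw [hψ, hL, e.symm_apply_apply]
    simp only at h2
    rw [h2]
    simp
  have hLmem : ∀ y, L y + o ∈ affineSpan ℝ (Set.range w) := fun y =>
    vadd_mem_affineSpan_of_mem_affineSpan_of_mem_vectorSpan ho (e.symm y).2
  have himage : ψ '' convexHull ℝ (Set.range w) = convexHull ℝ (Set.range (ψ ∘ w)) := by
    rw [AffineMap.image_convexHull, Set.range_comp]
  have hsub : ∀ x ∈ convexHull ℝ (Set.range w), x ∈ affineSpan ℝ (Set.range w) := fun x hx =>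
    convexHull_subset_affineSpan _ hx
  refine ⟨_, ψ '' convexHull ℝ (Set.range w), ψ,
    -- `y ↦ L y + o` parametrizes the affine hull of the columns; with matrix `-L` and right-hand
    -- side `o`, the slack of `y` in inequality `i` is coordinate `i` of the point with parameter
    -- `y`.
    ⟨ψ ∘ w, LinearMap.toMatrix' (-L), o, himage, ?_, fun i j => ?_⟩,
    ⟨_, Set.finite_range _, himage⟩, Set.InjOn.bijOn_image fun x hx y hy hxy => ?_⟩
  · ext y
    have hle : (∀ i, ((LinearMap.toMatrix' (-L)).mulVec y) i ≤ o i) ↔ ∀ i, 0 ≤ (L y + o) i := by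
      refine forall_congr' fun i => ?_
      rw [LinearMap.toMatrix'_mulVec]
      simp only [LinearMap.neg_apply, Pi.neg_apply, Pi.add_apply]
      constructor <;> intro h <;> linarith
    rw [Set.mem_ofPred_eq, hle]
    constructor
    · rintro ⟨x, hx, rfl⟩ i
      rw [hLψ x (hsub x hx)]
      have hconv : Convex ℝ {x : Fin m → ℝ | ∀ i, 0 ≤ x i} := convex_Ici (𝕜 := ℝ) (0 : Fin m → ℝ)
      exact convexHull_min (by rintro _ ⟨j, rfl⟩; exact hpos j) hconv hx i
    · exact fun h => ⟨_, hw _ (hLmem y) h, hψL y⟩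
  · have := congrFun (hLψ (w j) (subset_affineSpan _ _ ⟨j, rfl⟩)) i
    rw [LinearMap.toMatrix'_mulVec]
    simp only [Pi.add_apply] at this
    simp only [Matrix.of_apply, Function.comp_apply, LinearMap.neg_apply, Pi.neg_apply]
    linarith
  · rw [← hLψ x (hsub x hx), ← hLψ y (hsub y hy), hxy]

end Realization

/-! ### Polytopes with a separator are Cartesian products -/

section Sound

variable {m n d : ℕ}

/-- The rows of a matrix outside of `X` and those that are not facet rows, replaced by `0`. -/
noncomputable def facetRowsIn (S : Matrix (Fin m) (Fin n) ℝ) (X : Set (Fin m)) :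
    Matrix (Fin m) (Fin n) ℝ :=
  Matrix.of fun i j => X.indicator (maskedCol S {i | IsFacetRow S i} j) i

namespace IsSlackMap

variable {E : Type*} [NormedAddCommGroup E] [NormedSpace ℝ E] {S : Matrix (Fin m) (Fin n) ℝ}
  {v : Fin n → E} {T : Fin m → E →ᵃ[ℝ] ℝ} {X : Set (Fin m)}

/-- The part off `X` of the difference of the two slack vectors is again realized by a direction
`u`. Moving `x₁` along `u` exchanges the coordinates off `X` and keeps those in `X`; nonnegativity
of the facet slacks then puts the result into the hull. -/
theorem exists_mem_of_separator (h : IsSlackMap S v T) (hX : IsSeparator S X) {x₁ x₂ : E}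
    (h₁ : x₁ ∈ affineSpan ℝ (Set.range v)) (h₂ : x₂ ∈ affineSpan ℝ (Set.range v))
    (hp₁ : ∀ i ∈ X, 0 ≤ facetMap S T x₁ i) (hp₂ : ∀ i ∉ X, 0 ≤ facetMap S T x₂ i) :
    ∃ x ∈ convexHull ℝ (Set.range v), (∀ i ∈ X, facetMap S T x i = facetMap S T x₁ i) ∧
      ∀ i ∉ X, facetMap S T x i = facetMap S T x₂ i := by
  have hc := hX.compl _ (h.sub_mem_facetSpace h₂ h₁)
  rw [h.facetSpace_eq] at hc
  obtain ⟨u, hu, huc⟩ := hc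
  have hval : facetMap S T (u +ᵥ x₁) =
      Xᶜ.indicator (facetMap S T x₂ - facetMap S T x₁) + facetMap S T x₁ := by
    rw [AffineMap.map_vadd, huc, vadd_eq_add]
  have hin : ∀ i ∈ X, facetMap S T (u +ᵥ x₁) i = facetMap S T x₁ i := fun i hi => by
    rw [hval]
    simp [hi]
  have hout : ∀ i ∉ X, facetMap S T (u +ᵥ x₁) i = facetMap S T x₂ i := fun i hi => by
    rw [hval]
    simp [hi]
  refine ⟨u +ᵥ x₁, h.mem_of_facetRows
    (vadd_mem_affineSpan_of_mem_affineSpan_of_mem_vectorSpan h₁ hu) fun i hi => ?_, hin, hout⟩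
  rw [← facetMap_of_pos hi]
  by_cases hiX : i ∈ X
  · rw [hin i hiX]
    exact hp₁ i hiX
  · rw [hout i hiX]
    exact hp₂ i hiX

theorem facetMap_nonneg (h : IsSlackMap S v T) {x : E} (hx : x ∈ convexHull ℝ (Set.range v))
    (i : Fin m) : 0 ≤ facetMap S T x i := by
  by_cases hi : IsFacetRow S i
  · rw [facetMap_of_pos hi]
    exact h.nonneg_of_mem i hx
  · rw [facetMap_of_neg hi]

/-- The factor that belongs to a separator. -/
theorem exists_factor (h : IsSlackMap S v T) (hX : IsSeparator S X)
    (hi : ∃ i ∈ X, IsFacetRow S i) :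
    ∃ (d : ℕ) (P : Set (Fin d → ℝ)) (f : (Fin m → ℝ) →ᵃ[ℝ] (Fin d → ℝ)),
      IsSlackMatrix (facetRowsIn S X) P ∧ IsPolytope P ∧ P.Nontrivial ∧
        Set.BijOn f ((fun x => X.indicator (facetMap S T x)) '' convexHull ℝ (Set.range v)) P := by
  obtain ⟨i, hiX, hi⟩ := hi
  obtain ⟨j₀, j₁, hne⟩ := hi.1
  let g : E →ᵃ[ℝ] (Fin m → ℝ) := (indicatorLinear X).toAffineMap.comp (facetMap S T)
  have hg : ∀ x, g x = X.indicator (facetMap S T x) := fun x => rfl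
  have hgv : ∀ j, g (v j) = fun i => facetRowsIn S X i j := fun j => by
    rw [hg, h.facetMap_apply]
    rfl
  have himage : (fun x => X.indicator (facetMap S T x)) '' convexHull ℝ (Set.range v) =
      convexHull ℝ (Set.range (g ∘ v)) := by
    rw [Set.range_comp, ← AffineMap.image_convexHull]
    rfl
  obtain ⟨d, P, f, hS, hP, hf⟩ := exists_isSlackMatrix_of_columns (g ∘ v) j₀.pos
    (fun j i => by
      rw [Function.comp_apply, hg]
      exact Set.indicator_nonneg (fun i _ => h.facetMap_nonneg
        (subset_convexHull ℝ _ ⟨j, rfl⟩) i) i)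
    (fun x hx hpos => by
      rw [Set.range_comp, ← AffineSubspace.map_span] at hx
      obtain ⟨x₁, hx₁, rfl⟩ := hx
      have hv0 : v j₀ ∈ convexHull ℝ (Set.range v) := subset_convexHull ℝ _ ⟨j₀, rfl⟩
      -- Only the coordinates in `X` are prescribed; the others are borrowed from the point `v j₀`
      -- of the hull, where they are nonnegative.
      obtain ⟨y, hy, hin, -⟩ := h.exists_mem_of_separator hX hx₁
        (convexHull_subset_affineSpan _ hv0)
        (fun i hi => by simpa [g, hi] using hpos i) (fun i _ => h.facetMap_nonneg hv0 i)
      rw [← himage]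
      refine ⟨y, hy, ?_⟩
      ext i
      by_cases hi : i ∈ X
      · simp [g, hi, hin i hi]
      · simp [g, hi])
  refine ⟨d, P, f, ?_, hP, ?_, himage ▸ hf⟩
  · convert hS using 1
    ext i j
    simp [hgv]
  · refine ⟨f (g (v j₀)), hf.mapsTo (subset_convexHull ℝ _ ⟨j₀, rfl⟩), f (g (v j₁)),
      hf.mapsTo (subset_convexHull ℝ _ ⟨j₁, rfl⟩), fun heq => hne ?_⟩
    have := congrFun (hf.injOn (subset_convexHull ℝ _ ⟨j₀, rfl⟩)
      (subset_convexHull ℝ _ ⟨j₁, rfl⟩) heq) i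
    simpa [hgv, facetRowsIn, hiX, maskedCol, hi] using this

end IsSlackMap

/-- The two masked slack vectors jointly determine a point, since facet rows separate points, and
they can be chosen independently because `X` is a separator. Hence the pair of projections is a
bijection onto the product. -/
theorem IsSlackMatrix.exists_isProductOf {S : Matrix (Fin m) (Fin n) ℝ} {P : Set (Fin d → ℝ)}
    (h : IsSlackMatrix S P) {X : Set (Fin m)} (hX : IsSeparator S X)
    (h₁ : ∃ i ∈ X, IsFacetRow S i) (h₂ : ∃ i ∉ X, IsFacetRow S i) :
    ∃ (d₁ d₂ : ℕ) (P₁ : Set (Fin d₁ → ℝ)) (P₂ : Set (Fin d₂ → ℝ)), IsProductOf P P₁ P₂ ∧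
      IsSlackMatrix (facetRowsIn S X) P₁ ∧ IsSlackMatrix (facetRowsIn S Xᶜ) P₂ := by
  obtain ⟨v, T, rfl, hT⟩ := h.exists_isSlackMap
  obtain ⟨d₁, P₁, f₁, hS₁, hP₁, hn₁, hf₁⟩ := hT.exists_factor hX h₁
  obtain ⟨d₂, P₂, f₂, hS₂, hP₂, hn₂, hf₂⟩ := hT.exists_factor hX.compl h₂
  refine ⟨d₁, d₂, P₁, P₂, ⟨hP₁, hP₂, hn₁, hn₂, ?_⟩, hS₁, hS₂⟩
  refine ⟨(f₁.comp ((indicatorLinear X).toAffineMap.comp (facetMap S T))).prod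
    (f₂.comp ((indicatorLinear Xᶜ).toAffineMap.comp (facetMap S T))),
    fun x hx => ⟨hf₁.mapsTo ⟨x, hx, rfl⟩, hf₂.mapsTo ⟨x, hx, rfl⟩⟩, fun x hx y hy hxy => ?_, ?_⟩
  · have e₁ := hf₁.injOn ⟨x, hx, rfl⟩ ⟨y, hy, rfl⟩ (congrArg Prod.fst hxy)
    have e₂ := hf₂.injOn ⟨x, hx, rfl⟩ ⟨y, hy, rfl⟩ (congrArg Prod.snd hxy)
    refine hT.eq_of_facetRows hx (convexHull_subset_affineSpan _ hy) fun i hi => ?_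
    rw [← IsSlackMap.facetMap_of_pos hi x, ← IsSlackMap.facetMap_of_pos hi y]
    by_cases hiX : i ∈ X
    · simpa [hiX] using congrFun e₁ i
    · simpa [hiX] using congrFun e₂ i
  · rintro ⟨y₁, y₂⟩ ⟨hy₁, hy₂⟩
    obtain ⟨_, ⟨x₁, hx₁, rfl⟩, rfl⟩ := hf₁.surjOn hy₁
    obtain ⟨_, ⟨x₂, hx₂, rfl⟩, rfl⟩ := hf₂.surjOn hy₂
    obtain ⟨x, hx, hin, hout⟩ := hT.exists_mem_of_separator hX
      (convexHull_subset_affineSpan _ hx₁) (convexHull_subset_affineSpan _ hx₂)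
      (fun i _ => hT.facetMap_nonneg hx₁ i) (fun i _ => hT.facetMap_nonneg hx₂ i)
    refine ⟨x, hx, Prod.ext (congrArg f₁ (Set.indicator_congr hin))
      (congrArg f₂ (Set.indicator_congr hout))⟩

end Sound

/-! ### Separators and projection matrices -/

section Projection

variable {m n : ℕ}

open Matrix

/-- The matrix of the orthogonal projection onto a subspace. -/
structure IsProjectionMatrix (Q : Matrix (Fin m) (Fin m) ℝ) (C : Submodule ℝ (Fin m → ℝ)) :
    Prop where
  symm : ∀ i j, Q i j = Q j i
  apply_mem : ∀ c ∈ C, Q *ᵥ c = c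
  mem : ∀ j, (fun i => Q i j) ∈ C

theorem IsProjectionMatrix.mulVec_mem {Q : Matrix (Fin m) (Fin m) ℝ}
    {C : Submodule ℝ (Fin m → ℝ)} (hQ : IsProjectionMatrix Q C) (x : Fin m → ℝ) :
    Q *ᵥ x ∈ C := by
  have : Q *ᵥ x = ∑ j, x j • fun i => Q i j := by
    ext i
    simp [Matrix.mulVec, dotProduct, mul_comm]
  rw [this]
  exact Submodule.sum_mem _ fun j _ => Submodule.smul_mem _ _ (hQ.mem j)

/-- Orthogonality makes `Q` symmetric, so a coordinate mask preserves the space iff it commutes with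
`Q`, that is, iff `Q` is block diagonal for `X` and its complement. -/
theorem IsProjectionMatrix.isSeparator_iff {S : Matrix (Fin m) (Fin n) ℝ}
    {Q : Matrix (Fin m) (Fin m) ℝ} (hQ : IsProjectionMatrix Q (facetSpace S)) {X : Set (Fin m)} :
    IsSeparator S X ↔ ∀ i ∈ X, ∀ j ∉ X, Q i j = 0 := by
  classical
  constructor
  · intro hX i hi j hj
    -- Column `j` and row `i`, masked by `X`, both lie in the space and are fixed by `Q`. Entry `i`
    -- of the first identity and entry `j` of the second express `Q i j` and `0` by the same sum
    -- over `X`.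
    let e : Fin m → ℝ := fun i => X.indicator (fun i => Q i j) i
    let e' : Fin m → ℝ := fun j => X.indicator (fun j => Q i j) j
    have h1 : Q *ᵥ e = e := hQ.apply_mem _ (hX _ (hQ.mem j))
    have h2 : (fun l => Q i l) = fun l => Q l i := funext fun l => hQ.symm i l
    have h3 : Q *ᵥ e' = e' := hQ.apply_mem _ (hX _ (by rw [h2]; exact hQ.mem i))
    have h4 := congrFun h1 i
    have h5 := congrFun h3 j
    simp only [e, Set.indicator_of_mem hi] at h4
    simp only [e', Set.indicator_of_notMem hj] at h5
    rw [← h4, ← h5]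
    simp only [Matrix.mulVec, dotProduct]
    refine Finset.sum_congr rfl fun l _ => ?_
    by_cases hl : l ∈ X
    · simp [hl, mul_comm, hQ.symm l j]
    · simp [hl]
  · intro h0 c hc
    -- The missing cross entries let the mask pass through `Q c = c`.
    have hcomm : X.indicator c = Q *ᵥ X.indicator c := by
      have hc' := hQ.apply_mem c hc
      ext i
      by_cases hi : i ∈ X
      · rw [Set.indicator_of_mem hi, ← congrFun hc' i]
        simp only [Matrix.mulVec, dotProduct]
        refine Finset.sum_congr rfl fun l _ => ?_
        by_cases hl : l ∈ X
        · simp [hl]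
        · simp [hl, h0 i hi l hl]
      · rw [Set.indicator_of_notMem hi]
        simp only [Matrix.mulVec, dotProduct]
        refine (Finset.sum_eq_zero fun l _ => ?_).symm
        by_cases hl : l ∈ X
        · simp [hQ.symm i l, h0 l hl i hi]
        · simp [hl]
    rw [hcomm]
    exact hQ.mulVec_mem _

end Projection

/-! ### Structured programs -/

namespace RealRAM

@[simp] theorem Store.setVar_nat (s : Store) (x k : ℕ) : (s.setVar x k).nat = s.nat := rfl
@[simp] theorem Store.setVar_real (s : Store) (x k : ℕ) : (s.setVar x k).real = s.real := rfl

theorem Store.setVar_var (s : Store) (x k x' : ℕ) :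
    (s.setVar x k).var x' = if x' = x then k else s.var x' := rfl
theorem Store.setNat_nat (s : Store) (a i j k a' i' j' : ℕ) :
    (s.setNat a i j k).nat a' i' j' = if a' = a ∧ i' = i ∧ j' = j then k else s.nat a' i' j' := rfl
theorem Store.setReal_real (s : Store) (a i j : ℕ) (r : ℝ) (a' i' j' : ℕ) :
    (s.setReal a i j r).real a' i' j' =
      if a' = a ∧ i' = i ∧ j' = j then r else s.real a' i' j' := rfl

/-- Programs whose loops are counted: `forTo x y c` runs `c` with the variable `x` counting up from
`0`, as long as it is less than variable `y`, which is one of the two variables that hold the format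
of the input. -/
inductive Code : Type
  | skip
  | setVar (x : ℕ) (e : NatExpr)
  | setNat (a : ℕ) (i j : NatExpr) (e : NatExpr)
  | setReal (a : ℕ) (i j : NatExpr) (e : RealExpr)
  | seq (c₁ c₂ : Code)
  | ite (b : Test) (c₁ c₂ : Code)
  | forTo (x : ℕ) (y : Fin 2) (c : Code)

namespace Code

/-- The program of a structured program. -/
def toProgram : Code → Program
  | skip => .skip
  | setVar x e => .setVar x e
  | setNat a i j e => .setNat a i j e
  | setReal a i j e => .setReal a i j e
  | seq c₁ c₂ => .seq c₁.toProgram c₂.toProgram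
  | ite b c₁ c₂ => .ite b c₁.toProgram c₂.toProgram
  | forTo x y c => .seq (.setVar x (.const 0))
      (.loop (.natLt (.var x) (.var y)) (.seq c.toProgram (.setVar x (.add (.var x) (.const 1)))))

open Classical in
/-- The memory after the execution of a structured program. -/
noncomputable def exec : Code → Store → Store
  | skip, s => s
  | setVar x e, s => s.setVar x (e.eval s)
  | setNat a i j e, s => s.setNat a (i.eval s) (j.eval s) (e.eval s)
  | setReal a i j e, s => s.setReal a (i.eval s) (j.eval s) (e.eval s)
  | seq c₁ c₂, s => c₂.exec (c₁.exec s)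
  | ite b c₁ c₂, s => if b.Holds s then c₁.exec s else c₂.exec s
  | forTo x y c, s =>
      (fun s' => (c.exec s').setVar x ((c.exec s').var x + 1))^[s.var y] (s.setVar x 0)

/-- A bound for the number of steps, a polynomial in the format of the input. -/
noncomputable def bound : Code → MvPolynomial (Fin 2) ℕ
  | skip => 1
  | setVar _ e => (e.cost + 1 : ℕ)
  | setNat _ i j e => (i.cost + j.cost + e.cost + 1 : ℕ)
  | setReal _ i j e => (i.cost + j.cost + e.cost + 1 : ℕ)
  | seq c₁ c₂ => c₁.bound + c₂.bound
  | ite b c₁ c₂ => (b.cost + 1 : ℕ) + c₁.bound + c₂.bound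
  -- Initializing the counter takes 2 steps and the failing final test 4; each pass adds 4 for the
  -- test and 4 for the increment.
  | forTo _ y c => 6 + MvPolynomial.X y * (c.bound + 8)

/-- The variables that a structured program assigns to. -/
def varWrites : Code → List ℕ
  | setVar x _ => [x]
  | seq c₁ c₂ => c₁.varWrites ++ c₂.varWrites
  | ite _ c₁ c₂ => c₁.varWrites ++ c₂.varWrites
  | forTo x _ c => x :: c.varWrites
  | _ => []

/-- The arrays of natural numbers that a structured program writes to. -/
def natWrites : Code → List ℕ
  | setNat a _ _ _ => [a]
  | seq c₁ c₂ => c₁.natWrites ++ c₂.natWrites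
  | ite _ c₁ c₂ => c₁.natWrites ++ c₂.natWrites
  | forTo _ _ c => c.natWrites
  | _ => []

/-- The arrays of real numbers that a structured program writes to. -/
def realWrites : Code → List ℕ
  | setReal a _ _ _ => [a]
  | seq c₁ c₂ => c₁.realWrites ++ c₂.realWrites
  | ite _ c₁ c₂ => c₁.realWrites ++ c₂.realWrites
  | forTo _ _ c => c.realWrites
  | _ => []

/-- The program does not assign to the format of the input, and the bodies of loops do not assign to
their counters. -/
def wf : Code → Bool
  | setVar x _ => 2 ≤ x
  | seq c₁ c₂ => c₁.wf && c₂.wf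
  | ite _ c₁ c₂ => c₁.wf && c₂.wf
  | forTo x _ c => 2 ≤ x && x ∉ c.varWrites && c.wf
  | _ => true

/-- The memories `s` and `s'` differ at most in what the program may write. -/
structure SameOff (c : Code) (s s' : Store) : Prop where
  var : ∀ x ∉ c.varWrites, s'.var x = s.var x
  nat : ∀ a ∉ c.natWrites, s'.nat a = s.nat a
  real : ∀ a ∉ c.realWrites, s'.real a = s.real a

theorem SameOff.refl (c : Code) (s : Store) : SameOff c s s :=
  ⟨fun _ _ => rfl, fun _ _ => rfl, fun _ _ => rfl⟩

theorem SameOff.trans {c : Code} {s s' s'' : Store} (h : SameOff c s s') (h' : SameOff c s' s'') :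
    SameOff c s s'' :=
  ⟨fun x hx => (h'.var x hx).trans (h.var x hx), fun a ha => (h'.nat a ha).trans (h.nat a ha),
    fun a ha => (h'.real a ha).trans (h.real a ha)⟩

theorem SameOff.mono {c c' : Code} {s s' : Store} (h : SameOff c s s')
    (hv : c.varWrites ⊆ c'.varWrites) (hn : c.natWrites ⊆ c'.natWrites)
    (hr : c.realWrites ⊆ c'.realWrites) : SameOff c' s s' :=
  ⟨fun x hx => h.var x fun h' => hx (hv h'), fun a ha => h.nat a fun h' => ha (hn h'),
    fun a ha => h.real a fun h' => ha (hr h')⟩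

theorem SameOff.setVar {c : Code} {s s' : Store} (h : SameOff c s s') {x : ℕ}
    (hx : x ∈ c.varWrites) (k : ℕ) : SameOff c s (s'.setVar x k) :=
  ⟨fun x' hx' => by
    rw [Store.setVar_var, if_neg (by rintro rfl; exact hx' hx), h.var x' hx'], h.nat, h.real⟩

theorem sameOff_forTo_step {x : ℕ} {y : Fin 2} {c : Code} {s s' : Store}
    (h : SameOff (forTo x y c) s s') (hc : SameOff c s' (c.exec s')) (k : ℕ) :
    SameOff (forTo x y c) s ((c.exec s').setVar x k) :=
  (h.trans (hc.mono (List.subset_cons_self _ _) (List.Subset.refl _)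
    (List.Subset.refl _))).setVar
    List.mem_cons_self k

theorem sameOff_exec (c : Code) (s : Store) : SameOff c s (c.exec s) := by
  induction c generalizing s with
  | skip => exact .refl _ s
  | setVar x e => exact (SameOff.refl _ s).setVar (List.mem_singleton_self x) _
  | setNat a i j e =>
    refine ⟨fun _ _ => rfl, fun a' ha => ?_, fun _ _ => rfl⟩
    ext i' j'
    have : a' ≠ a := by simpa [natWrites] using ha
    simp [exec, Store.setNat_nat, this]
  | setReal a i j e =>
    refine ⟨fun _ _ => rfl, fun _ _ => rfl, fun a' ha => ?_⟩
    ext i' j'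
    have : a' ≠ a := by simpa [realWrites] using ha
    simp [exec, Store.setReal_real, this]
  | seq c₁ c₂ ih₁ ih₂ =>
    exact ((ih₁ s).mono (List.subset_append_left _ _) (List.subset_append_left _ _)
      (List.subset_append_left _ _)).trans ((ih₂ _).mono (List.subset_append_right _ _)
      (List.subset_append_right _ _) (List.subset_append_right _ _))
  | ite b c₁ c₂ ih₁ ih₂ =>
    rw [exec]
    split_ifs
    · exact (ih₁ s).mono (List.subset_append_left _ _) (List.subset_append_left _ _)
        (List.subset_append_left _ _)
    · exact (ih₂ s).mono (List.subset_append_right _ _) (List.subset_append_right _ _)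
        (List.subset_append_right _ _)
  | forTo x y c ih =>
    rw [exec]
    have h0 : SameOff (forTo x y c) s (s.setVar x 0) := (SameOff.refl _ s).setVar (by simp [varWrites]) 0
    generalize s.var y = K
    induction K with
    | zero => exact h0
    | succ K ihK =>
      rw [Function.iterate_succ_apply']
      exact sameOff_forTo_step ihK (ih _) _

theorem two_le_of_mem_varWrites {c : Code} (h : c.wf = true) {x : ℕ} (hx : x ∈ c.varWrites) :
    2 ≤ x := by
  induction c with
  | setVar x' e => simp_all [wf, varWrites]
  | seq c₁ c₂ ih₁ ih₂ =>
    simp only [wf, Bool.and_eq_true, varWrites, List.mem_append] at h hx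
    exact hx.elim (ih₁ h.1) (ih₂ h.2)
  | ite b c₁ c₂ ih₁ ih₂ =>
    simp only [wf, Bool.and_eq_true, varWrites, List.mem_append] at h hx
    exact hx.elim (ih₁ h.1) (ih₂ h.2)
  | forTo x' y c ih =>
    simp only [wf, Bool.and_eq_true, decide_eq_true_eq, varWrites, List.mem_cons] at h hx
    rcases hx with rfl | hx
    exacts [h.1.1, ih h.2 hx]
  | _ => simp [varWrites] at hx

theorem exec_format {c : Code} (h : c.wf = true) (s : Store) (y : Fin 2) :
    (c.exec s).var y = s.var y :=
  (sameOff_exec c s).var _ fun hy => absurd (two_le_of_mem_varWrites h hy) (by omega)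

/-- The rule for counted loops. -/
theorem exec_forTo {x : ℕ} {y : Fin 2} {c : Code} (hwf : (forTo x y c).wf = true) {s : Store}
    (I : ℕ → Store → Prop) (h0 : I 0 (s.setVar x 0))
    (hstep : ∀ k < s.var y, ∀ s', s'.var x = k → SameOff (forTo x y c) s s' → I k s' →
      I (k + 1) ((c.exec s').setVar x (k + 1))) :
    I (s.var y) ((forTo x y c).exec s) := by
  have hx : x ∉ c.varWrites := by
    simp only [wf, Bool.and_eq_true, decide_eq_true_eq] at hwf
    exact hwf.1.2
  suffices h : ∀ K ≤ s.var y, ∀ s',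
      s' = (fun s' => (c.exec s').setVar x ((c.exec s').var x + 1))^[K] (s.setVar x 0) →
      s'.var x = K ∧ SameOff (forTo x y c) s s' ∧ I K s' from (h _ le_rfl _ rfl).2.2
  intro K
  induction K with
  | zero =>
    rintro - s' rfl
    exact ⟨by simp [Store.setVar_var], (SameOff.refl _ s).setVar (by simp [varWrites]) 0, h0⟩
  | succ K ih =>
    rintro hK s' rfl
    rw [Function.iterate_succ_apply']
    obtain ⟨h1, h2, h3⟩ := ih (by omega) _ rfl
    set s' := (fun s' => (c.exec s').setVar x ((c.exec s').var x + 1))^[K] (s.setVar x 0)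
    have hv : (c.exec s').var x = K := by rw [(sameOff_exec c s').var x hx, h1]
    simp only [hv]
    exact ⟨by simp [Store.setVar_var], sameOff_forTo_step h2 (sameOff_exec c s') _,
      hstep K (by omega) s' h1 h2 h3⟩

/-- Structured programs run as specified, within their time bound. -/
theorem runs_exec {c : Code} (h : c.wf = true) (s : Store) :
    ∃ t, Runs c.toProgram s (c.exec s) t ∧
      t ≤ MvPolynomial.eval ![s.var 0, s.var 1] c.bound := by
  induction c generalizing s with
  | skip => exact ⟨1, .skip s, by simp [bound]⟩
  | setVar x e => exact ⟨_, .setVar s x e, by simp [bound]⟩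
  | setNat a i j e => exact ⟨_, .setNat s a i j e, by simp [bound]⟩
  | setReal a i j e => exact ⟨_, .setReal s a i j e, by simp [bound]⟩
  | seq c₁ c₂ ih₁ ih₂ =>
    simp only [wf, Bool.and_eq_true] at h
    obtain ⟨t₁, h₁, b₁⟩ := ih₁ h.1 s
    obtain ⟨t₂, h₂, b₂⟩ := ih₂ h.2 (c₁.exec s)
    have e0 := exec_format h.1 s 0
    have e1 := exec_format h.1 s 1
    simp only [Fin.val_zero, Fin.val_one] at e0 e1
    rw [e0, e1] at b₂
    exact ⟨_, .seq h₁ h₂, by rw [bound, map_add]; omega⟩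
  | ite b c₁ c₂ ih₁ ih₂ =>
    simp only [wf, Bool.and_eq_true] at h
    obtain ⟨t₁, h₁, b₁⟩ := ih₁ h.1 s
    obtain ⟨t₂, h₂, b₂⟩ := ih₂ h.2 s
    by_cases hb : b.Holds s
    · rw [exec, if_pos hb]
      exact ⟨_, .iteTrue hb h₁, by rw [bound, map_add, map_add, map_natCast]; simp; omega⟩
    · rw [exec, if_neg hb]
      exact ⟨_, .iteFalse hb h₂, by rw [bound, map_add, map_add, map_natCast]; simp; omega⟩
  | forTo x y c ih =>
    have hx : x ∉ c.varWrites ∧ 2 ≤ x ∧ c.wf = true := by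
      simp only [wf, Bool.and_eq_true, decide_eq_true_eq] at h
      exact ⟨h.1.2, h.1.1, h.2⟩
    obtain ⟨hx, hx2, hc⟩ := hx
    set B := MvPolynomial.eval ![s.var 0, s.var 1] c.bound with hB
    have hxy : ∀ y : Fin 2, (y : ℕ) ≠ x := fun y => by omega
    have key : ∀ r, ∀ s' : Store, s'.var 0 = s.var 0 → s'.var 1 = s.var 1 →
        s'.var x + r = s'.var y → ∃ t, Runs (.loop (.natLt (.var x) (.var y))
          (.seq c.toProgram (.setVar x (.add (.var x) (.const 1))))) s'
          ((fun s' => (c.exec s').setVar x ((c.exec s').var x + 1))^[r] s') t ∧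
          t ≤ r * (B + 8) + 4 := by
      intro r
      induction r with
      | zero =>
        intro s' _ _ hr
        exact ⟨_, .loopDone (by simp [Test.Holds, NatExpr.eval]; omega),
          by simp [Test.cost, NatExpr.cost]⟩
      | succ r ihr =>
        intro s' h0 h1 hr
        obtain ⟨t, ht, hbt⟩ := ih hc s'
        rw [h0, h1, ← hB] at hbt
        have hf : ∀ y : Fin 2, ((c.exec s').setVar x ((c.exec s').var x + 1)).var y = s'.var y :=
          fun y => by rw [Store.setVar_var, if_neg (hxy y), exec_format hc]
        have hv : (c.exec s').var x = s'.var x := (sameOff_exec c s').var x hx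
        obtain ⟨t', ht', hbt'⟩ := ihr ((c.exec s').setVar x ((c.exec s').var x + 1))
          ((hf 0).trans h0) ((hf 1).trans h1)
          (by rw [hf, Store.setVar_var, if_pos rfl, hv]; omega)
        rw [Function.iterate_succ_apply]
        refine ⟨_, .loopStep (by simp [Test.Holds, NatExpr.eval]; omega)
          (.seq ht (.setVar _ x _)) ht', ?_⟩
        simp only [Test.cost, NatExpr.cost]
        rw [add_one_mul]
        omega
    have hf : ∀ y : Fin 2, (s.setVar x 0).var y = s.var y := fun y => by
      rw [Store.setVar_var, if_neg (hxy y)]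
    obtain ⟨t, ht, hbt⟩ := key (s.var y) (s.setVar x 0) (hf 0) (hf 1)
      (by rw [hf, Store.setVar_var, if_pos rfl, zero_add])
    refine ⟨_, .seq (.setVar s x (.const 0)) ht, ?_⟩
    have hX : MvPolynomial.eval ![s.var 0, s.var 1] (MvPolynomial.X y) = s.var y := by
      rw [MvPolynomial.eval_X]
      fin_cases y <;> rfl
    simp only [bound, map_add, map_mul, hX, ← hB, map_ofNat, NatExpr.cost]
    omega

end Code

end RealRAM

namespace RealRAM

namespace Code

/-! ### Loop patterns -/

theorem SameOff.seq_left {c₁ c₂ : Code} {s s' : Store} (h : SameOff c₁ s s') :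
    SameOff (c₁.seq c₂) s s' :=
  h.mono (List.subset_append_left _ _) (List.subset_append_left _ _)
    (List.subset_append_left _ _)

theorem SameOff.seq_right {c₁ c₂ : Code} {s s' : Store} (h : SameOff c₂ s s') :
    SameOff (c₁.seq c₂) s s' :=
  h.mono (List.subset_append_right _ _) (List.subset_append_right _ _)
    (List.subset_append_right _ _)

/-- Let the variable `z` tell whether the test `b`, made after `c`, succeeds for some value of the
counter `x`. -/
def existsFor (x : ℕ) (y : Fin 2) (c : Code) (b : Test) (z : ℕ) : Code :=
  .seq (.setVar z (.const 0)) (.forTo x y (.seq c (.ite b (.setVar z (.const 1)) .skip)))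

/-- The test need only be understood in memories that differ from `s` in what the loop itself
writes. Since neither the counter nor `c` touches the flag `z`, the flag records whether an earlier
value succeeded. -/
theorem existsFor_spec {x : ℕ} {y : Fin 2} {c : Code} {b : Test} {z : ℕ}
    (hwf : (existsFor x y c b z).wf = true) (hz : z ∉ x :: c.varWrites) {s : Store} {P : ℕ → Prop}
    (hP : ∀ k < s.var y, ∀ s', s'.var x = k → SameOff (existsFor x y c b z) s s' →
      (b.Holds (c.exec s') ↔ P k))
    [Decidable (∃ k < s.var y, P k)] :
    ((existsFor x y c b z).exec s).var z = if ∃ k < s.var y, P k then 1 else 0 := by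
  classical
  simp only [existsFor, wf, Bool.and_eq_true] at hwf
  have hzy : (y : ℕ) ≠ z := by
    have := hwf.1
    simp only [decide_eq_true_eq] at this
    omega
  rw [List.mem_cons, not_or] at hz
  have hs : ((setVar z (.const 0)).exec s).var y = s.var y := by
    rw [exec, Store.setVar_var, if_neg hzy]
  have h1 := sameOff_exec (setVar z (.const 0)) s
  have := exec_forTo (x := x) (y := y) (c := .seq c (.ite b (.setVar z (.const 1)) .skip))
    (by simpa [wf] using hwf.2) (s := (setVar z (.const 0)).exec s)
    (fun k s' => s'.var z = if ∃ l < k, P l then 1 else 0)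
    (by simp [exec, Store.setVar_var, hz.1, NatExpr.eval]) ?_
  · rw [hs] at this
    rw [existsFor, exec]
    convert this
  · intro k hk s' hx hs' hI
    have hPk := hP k (hs ▸ hk) s' hx (h1.seq_left.trans hs'.seq_right)
    have hv := (sameOff_exec c s').var z hz.2
    rw [Store.setVar_var, if_neg hz.1, exec, exec]
    by_cases hk' : P k
    · rw [if_pos (hPk.2 hk'), if_pos ⟨k, by omega, hk'⟩]
      simp [exec, Store.setVar_var, NatExpr.eval]
    · rw [if_neg (mt hPk.1 hk'), exec, hv, hI]
      refine if_congr ⟨fun ⟨l, hl, h⟩ => ⟨l, by omega, h⟩, fun ⟨l, hl, h⟩ => ⟨l, ?_, h⟩⟩ rfl rfl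
      rcases Nat.lt_succ_iff_lt_or_eq.1 hl with h' | rfl
      exacts [h', absurd h hk']

/-- Write the values of `e`, computed after `c`, to the first column of an array. -/
def mapNat (x : ℕ) (y : Fin 2) (c : Code) (a : ℕ) (e : NatExpr) : Code :=
  .forTo x y (.seq c (.setNat a (.var x) (.const 0) e))

/-- The assumption that entry `k` is still the original one when it is processed allows an array to
be rewritten in place, as `joinCode` does with the labels. -/
theorem mapNat_spec {x : ℕ} {y : Fin 2} {c : Code} {a : ℕ} {e : NatExpr}
    (hwf : (mapNat x y c a e).wf = true) (ha : a ∉ c.natWrites) {s : Store} {V : ℕ → ℕ}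
    (hV : ∀ k < s.var y, ∀ s', s'.var x = k → SameOff (mapNat x y c a e) s s' →
      s'.nat a k 0 = s.nat a k 0 → e.eval (c.exec s') = V k) :
    ∀ k < s.var y, ((mapNat x y c a e).exec s).nat a k 0 = V k := by
  have hx : x ∉ c.varWrites := by
    simp only [mapNat, wf, Bool.and_eq_true, decide_eq_true_eq, varWrites, List.append_nil] at hwf
    exact hwf.1.2
  have := exec_forTo hwf (s := s) (fun k s' => ∀ l, s'.nat a l 0 = if l < k then V l else s.nat a l 0)
    (by simp) ?_
  · intro k hk
    rw [mapNat, this k, if_pos hk]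
  · intro k hk s' hxk hs' hI l
    have hVk := hV k hk s' hxk hs' (by rw [hI, if_neg (lt_irrefl k)])
    rw [Store.setVar_nat, exec, exec, hVk, Store.setNat_nat]
    simp only [NatExpr.eval, true_and, and_true]
    rw [(sameOff_exec c s').var x hx, hxk, (sameOff_exec c s').nat a ha, hI]
    rcases lt_trichotomy l k with h | rfl | h
    · rw [if_neg h.ne, if_pos h, if_pos (by omega)]
    · simp
    · rw [if_neg h.ne', if_neg (by omega), if_neg (by omega)]

/-- Write the values of `e`, computed after `c`, to the first column of an array. -/
def mapReal (x : ℕ) (y : Fin 2) (c : Code) (a : ℕ) (e : RealExpr) : Code :=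
  .forTo x y (.seq c (.setReal a (.var x) (.const 0) e))

theorem mapReal_spec {x : ℕ} {y : Fin 2} {c : Code} {a : ℕ} {e : RealExpr}
    (hwf : (mapReal x y c a e).wf = true) (ha : a ∉ c.realWrites) {s : Store} {V : ℕ → ℝ}
    (hV : ∀ k < s.var y, ∀ s', s'.var x = k → SameOff (mapReal x y c a e) s s' →
      e.eval (c.exec s') = V k) :
    ∀ k < s.var y, ((mapReal x y c a e).exec s).real a k 0 = V k := by
  have hx : x ∉ c.varWrites := by
    simp only [mapReal, wf, Bool.and_eq_true, decide_eq_true_eq, varWrites, List.append_nil] at hwf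
    exact hwf.1.2
  refine exec_forTo hwf (s := s) (fun k s' => ∀ l < k, s'.real a l 0 = V l) (by simp) ?_
  intro k hk s' hxk hs' hI l hl
  have hVk := hV k hk s' hxk hs'
  rw [Store.setVar_real, exec, exec, hVk, Store.setReal_real]
  simp only [NatExpr.eval, true_and, and_true]
  rw [(sameOff_exec c s').var x hx, hxk, (sameOff_exec c s').real a ha]
  rcases Nat.lt_succ_iff_lt_or_eq.1 hl with h | rfl
  · rw [if_neg h.ne, hI l h]
  · simp

/-- Write the values of `e`, computed after `c`, to the entries of an array. -/
def mapReal₂ (x : ℕ) (y : Fin 2) (x' : ℕ) (y' : Fin 2) (c : Code) (a : ℕ) (e : RealExpr) : Code :=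
  .forTo x y (.forTo x' y' (.seq c (.setReal a (.var x) (.var x') e)))

/-- Here, too, an entry may be computed from its own old value; the update of the projection matrix
happens in place. -/
theorem mapReal₂_spec {x : ℕ} {y : Fin 2} {x' : ℕ} {y' : Fin 2} {c : Code} {a : ℕ} {e : RealExpr}
    (hwf : (mapReal₂ x y x' y' c a e).wf = true) (ha : a ∉ c.realWrites) {s : Store}
    {V : ℕ → ℕ → ℝ}
    (hV : ∀ k < s.var y, ∀ k' < s.var y', ∀ s', s'.var x = k → s'.var x' = k' →
      SameOff (mapReal₂ x y x' y' c a e) s s' → s'.real a k k' = s.real a k k' →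
      e.eval (c.exec s') = V k k') :
    ∀ k < s.var y, ∀ k' < s.var y', ((mapReal₂ x y x' y' c a e).exec s).real a k k' = V k k' := by
  have hwf' := hwf
  simp only [mapReal₂, wf, Bool.and_eq_true, decide_eq_true_eq, varWrites, List.append_nil,
    List.mem_cons, not_or] at hwf'
  obtain ⟨⟨hx2, hxx', hx⟩, ⟨hx2', hx'⟩, -⟩ := hwf'
  have := exec_forTo hwf (s := s) (fun k s' => ∀ l l', l' < s.var y' →
    s'.real a l l' = if l < k then V l l' else s.real a l l') (by simp) ?_
  · intro k hk k' hk'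
    rw [mapReal₂, this k k' hk', if_pos hk]
  · intro k hk s₁ hxk hs₁ hI
    have hy' : s₁.var y' = s.var y' := hs₁.var _ fun h =>
      absurd (two_le_of_mem_varWrites hwf h) (by omega)
    have hinner := exec_forTo (x := x') (y := y') (c := .seq c (.setReal a (.var x) (.var x') e))
      (by simp only [mapReal₂, wf, Bool.and_eq_true] at hwf ⊢; exact hwf.2) (s := s₁)
      -- The entries already written are those that precede `(k, k')` lexicographically.
      (fun k' s' => ∀ l l', l' < s.var y' → s'.real a l l' =
        if l < k ∨ l = k ∧ l' < k' then V l l' else s.real a l l')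
      (by simpa using hI) ?_
    · intro l l' hl'
      rw [Store.setVar_real, hinner l l' hl', hy']
      refine if_congr ⟨?_, ?_⟩ rfl rfl
      · rintro (h | ⟨rfl, -⟩) <;> omega
      · intro h
        rcases Nat.lt_succ_iff_lt_or_eq.1 h with h | rfl
        exacts [.inl h, .inr ⟨rfl, hl'⟩]
    · intro k' hk' s₂ hxk' hs₂ hI₂ l l' hl'
      have hx₂ : s₂.var x = k := by
        rw [hs₂.var x (by simpa [varWrites] using ⟨hxx', hx⟩), hxk]
      have hVk := hV k hk k' (hy' ▸ hk') s₂ hx₂ hxk'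
        (hs₁.trans (hs₂.mono (List.subset_cons_self _ _) (List.Subset.refl _)
          (List.Subset.refl _)))
        (by rw [hI₂ _ _ (hy' ▸ hk'), if_neg (by omega)])
      rw [Store.setVar_real, exec, exec, hVk, Store.setReal_real]
      simp only [NatExpr.eval, true_and]
      rw [(sameOff_exec c s₂).var x hx, (sameOff_exec c s₂).var x' hx', hx₂, hxk',
        (sameOff_exec c s₂).real a ha, hI₂ l l' hl']
      by_cases h : l = k ∧ l' = k'
      · rw [if_pos h, if_pos (by omega), h.1, h.2]
      · rw [if_neg h]
        exact if_congr (by omega) rfl rfl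

/-- Sum the values of `e`, with the result at position `(0, 0)` of the array `a`. -/
def sumFor (x : ℕ) (y : Fin 2) (a : ℕ) (e : RealExpr) : Code :=
  .seq (.setReal a (.const 0) (.const 0) (.const 0))
    (.forTo x y (.setReal a (.const 0) (.const 0) (.add (.get a (.const 0) (.const 0)) e)))

theorem sumFor_spec {x : ℕ} {y : Fin 2} {a : ℕ} {e : RealExpr}
    (hwf : (sumFor x y a e).wf = true) {s : Store} {V : ℕ → ℝ}
    (hV : ∀ k < s.var y, ∀ s', s'.var x = k → SameOff (sumFor x y a e) s s' → e.eval s' = V k) :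
    ((sumFor x y a e).exec s).real a 0 0 = ∑ k ∈ Finset.range (s.var y), V k := by
  have h1 := sameOff_exec (setReal a (.const 0) (.const 0) (.const 0)) s
  simp only [sumFor, wf, Bool.and_eq_true] at hwf
  refine exec_forTo (x := x) (y := y)
    (c := .setReal a (.const 0) (.const 0) (.add (.get a (.const 0) (.const 0)) e))
    (by simpa [wf] using hwf.2)
    (s := (setReal a (.const 0) (.const 0) (.const 0)).exec s)
    (fun k s' => s'.real a 0 0 = ∑ k ∈ Finset.range k, V k) ?_ ?_
  · simp [exec, Store.setReal_real, NatExpr.eval, RealExpr.eval]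
  · intro k hk s' hx hs' hI
    have hVk := hV k hk s' hx (h1.seq_left.trans hs'.seq_right)
    rw [Store.setVar_real, exec, Store.setReal_real, Finset.sum_range_succ]
    simp [NatExpr.eval, RealExpr.eval, hI, hVk]

end Code

end RealRAM

/-! ### Projection matrices, one generator at a time -/

open Matrix in
/-- One step of the Gram-Schmidt process. -/
theorem IsProjectionMatrix.sup_span {m : ℕ} {Q : Matrix (Fin m) (Fin m) ℝ}
    {C : Submodule ℝ (Fin m → ℝ)} (hQ : IsProjectionMatrix Q C) {u w : Fin m → ℝ}
    (hw : w = u - Q *ᵥ u) :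
    IsProjectionMatrix (Matrix.of fun i j => Q i j + w i * w j / (w ⬝ᵥ w)) (C ⊔ ℝ ∙ u) := by
  have hsymm : ∀ x y : Fin m → ℝ, (Q *ᵥ x) ⬝ᵥ y = x ⬝ᵥ (Q *ᵥ y) := fun x y => by
    have : Qᵀ = Q := by ext i j; exact hQ.symm j i
    rw [dotProduct_mulVec, ← mulVec_transpose, this]
  have hperp : ∀ c ∈ C, w ⬝ᵥ c = 0 := fun c hc => by
    rw [hw, sub_dotProduct, hsymm, hQ.apply_mem c hc, sub_self]
  have hwu : w ⬝ᵥ u = w ⬝ᵥ w := by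
    conv_rhs => rw [hw, dotProduct_sub, ← hw, hperp _ (hQ.mulVec_mem u), sub_zero]
  have happly : ∀ x, (Matrix.of fun i j => Q i j + w i * w j / (w ⬝ᵥ w)) *ᵥ x =
      Q *ᵥ x + (w ⬝ᵥ x / (w ⬝ᵥ w)) • w := fun x => by
    ext i
    simp only [mulVec, dotProduct, Matrix.of_apply, add_mul, Finset.sum_add_distrib, Pi.add_apply,
      Pi.smul_apply, smul_eq_mul, Finset.sum_div, Finset.sum_mul]
    congr 1
    refine Finset.sum_congr rfl fun j _ => ?_
    ring
  have hwC : w ∈ C ⊔ ℝ ∙ u := by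
    rw [hw]
    exact Submodule.sub_mem _ (Submodule.mem_sup_right (Submodule.mem_span_singleton_self u))
      (Submodule.mem_sup_left (hQ.mulVec_mem u))
  refine ⟨fun i j => ?_, fun c hc => ?_, fun j => ?_⟩
  · simp only [Matrix.of_apply, hQ.symm i j, mul_comm]
  · obtain ⟨c, hcC, _, hu, rfl⟩ := Submodule.mem_sup.1 hc
    obtain ⟨r, rfl⟩ := Submodule.mem_span_singleton.1 hu
    rw [happly, mulVec_add, hQ.apply_mem c hcC, dotProduct_add, hperp c hcC, zero_add,
      dotProduct_smul, hwu, mulVec_smul, add_assoc]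
    congr 1
    -- If `u` already lies in the space, then `w = 0` and the division by `0` returns `0`: the
    -- matrix stays as it is, as it should.
    by_cases h0 : w ⬝ᵥ w = 0
    · have h1 : w = 0 := dotProduct_self_eq_zero.1 h0
      rw [h1, smul_zero, add_zero]
      rw [h1, eq_comm, sub_eq_zero] at hw
      rw [← hw]
    · rw [smul_eq_mul, mul_div_assoc, div_self h0, mul_one, ← smul_add, hw, add_sub_cancel]
  · have : (fun i => (Matrix.of fun i j => Q i j + w i * w j / (w ⬝ᵥ w)) i j) =
        (fun i => Q i j) + (w j / (w ⬝ᵥ w)) • w := by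
      ext i
      simp only [Matrix.of_apply, Pi.add_apply, Pi.smul_apply, smul_eq_mul]
      ring
    rw [this]
    exact Submodule.add_mem _ (Submodule.mem_sup_left (hQ.mem j)) (Submodule.smul_mem _ _ hwC)

namespace RealRAM

namespace Code

/-! ### The algorithm

The natural array `0` marks the nonconstant rows and the array `1` the facet rows. The real array
`3` holds the facet rows, translated so that the first column is `0`, and the array `4` the
projection matrix onto the span of its columns. The natural array `2` numbers the components of the
support of that matrix. -/

/-- An entry of a matrix, the row and the column given by variables. -/
def entry (a i j : ℕ) : RealExpr := .get a (.var i) (.var j)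

/-- An entry of a list of real numbers, the index given by a variable. -/
def realItem (a i : ℕ) : RealExpr := .get a (.var i) (.const 0)

/-- An entry of a list of natural numbers, the index given by a variable. -/
def natItem (a i : ℕ) : NatExpr := .get a (.var i) (.const 0)

/-- A test whether an entry of a matrix is `0`. -/
def isZero (a i j : ℕ) : Test := .realEq (entry a i j) (.const 0)

/-- Mark the nonconstant rows. -/
def nonconstCode : Code :=
  mapNat 10 0 (existsFor 11 1 .skip (.not (.realEq (entry 0 10 11) (realItem 0 10))) 20) 0 (.var 20)

/-- Compare the zero sets of two rows. -/
def compareCode : Code :=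
  .seq (existsFor 12 1 .skip (.and (isZero 0 10 12) (.not (isZero 0 11 12))) 21)
    (existsFor 12 1 .skip (.and (isZero 0 11 12) (.not (isZero 0 10 12))) 22)

/-- Decide whether some nonconstant row has a larger zero set. -/
def largerCode : Code :=
  existsFor 11 0 compareCode (.and (.natEq (natItem 0 11) (.const 1))
    (.and (.natEq (.var 21) (.const 0)) (.natEq (.var 22) (.const 1)))) 23

/-- Mark the facet rows. -/
def facetCode : Code :=
  -- With both marks in `{0, 1}`, truncated subtraction computes "nonconstant and no larger zero
  -- set".
  mapNat 10 0 largerCode 1 (.sub (natItem 0 10) (.var 23))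

/-- Write `e` or `0` to an auxiliary place. -/
def guardCode (b : Test) (e : RealExpr) : Code :=
  .ite b (.setReal 7 (.const 0) (.const 0) e) (.setReal 7 (.const 0) (.const 0) (.const 0))

/-- Translate the facet rows. -/
def diffCode : Code :=
  mapReal₂ 10 0 11 1 (guardCode (.natEq (natItem 1 10) (.const 1))
    (.sub (entry 0 10 11) (realItem 0 10))) 3 (.get 7 (.const 0) (.const 0))

/-- Compute the component of a column that is orthogonal to the previous columns. -/
def orthCode : Code :=
  mapReal 10 0 (sumFor 12 0 6 (.mul (entry 4 10 12) (entry 3 12 13))) 5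
    (.sub (entry 3 10 13) (.get 6 (.const 0) (.const 0)))

/-- Update the projection matrix. -/
def updateCode : Code :=
  .seq (sumFor 10 0 6 (.mul (realItem 5 10) (realItem 5 10)))
    (mapReal₂ 10 0 12 0 .skip 4 (.add (entry 4 10 12)
      (.div (.mul (realItem 5 10) (realItem 5 12)) (.get 6 (.const 0) (.const 0)))))

/-- Compute the projection matrix. -/
def projCode : Code := .forTo 13 1 (.seq orthCode updateCode)

/-- Give each row a component of its own. -/
def initCode : Code := mapNat 10 0 .skip 2 (.var 10)

/-- Join the components of two rows. -/
def joinCode : Code :=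
  -- Both labels are saved first, since the relabelling loop may overwrite them in the array.
  .seq (.setVar 24 (natItem 2 10)) (.seq (.setVar 25 (natItem 2 11))
    (mapNat 12 0 (.ite (.natEq (natItem 2 12) (.var 24)) (.setVar 26 (.var 25))
      (.setVar 26 (natItem 2 12))) 2 (.var 26)))

/-- Join the components of all adjacent rows. -/
def compCode : Code :=
  .forTo 10 0 (.forTo 11 0 (.ite (.not (isZero 4 10 11)) joinCode .skip))

/-- Pick the component of a facet row. -/
def pickCode : Code :=
  .forTo 10 0 (.ite (.natEq (natItem 1 10) (.const 1)) (.setVar 27 (natItem 2 10)) .skip)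

/-- A test for the facet rows in the component that was picked. -/
def insideTest : Test := .and (.natEq (natItem 1 10) (.const 1)) (.natEq (natItem 2 10) (.var 27))

/-- A test for the facet rows in the other components. -/
def outsideTest : Test :=
  .and (.natEq (natItem 1 10) (.const 1)) (.not (.natEq (natItem 2 10) (.var 27)))

/-- Decide whether there is more than one component. -/
def answerCode : Code := existsFor 10 0 .skip outsideTest 28

/-- Copy the rows of the input that satisfy a test. -/
def copyCode (b : Test) (a : ℕ) : Code :=
  mapReal₂ 10 0 11 1 (guardCode b (entry 0 10 11)) a (.get 7 (.const 0) (.const 0))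

/-- The algorithm. -/
def mainCode : Code :=
  .seq nonconstCode (.seq facetCode (.seq diffCode (.seq projCode (.seq initCode (.seq compCode
    (.seq pickCode (.seq answerCode (.seq (copyCode insideTest 1) (copyCode outsideTest 2)))))))))

/-! ### What each piece of the algorithm computes -/

open Classical in
theorem nonconst_spec (s : Store) : ∀ i < s.var 0, (nonconstCode.exec s).nat 0 i 0 =
    if ∃ j < s.var 1, s.real 0 i j ≠ s.real 0 i 0 then 1 else 0 := by
  refine mapNat_spec (y := 0) ?_ ?_ ?_
  · rfl
  · decide
  intro i hi s₁ hx h₁ _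
  rw [NatExpr.eval, existsFor_spec rfl (by decide)
    (P := fun j => s.real 0 i j ≠ s.real 0 i 0), Fin.val_one, h₁.var 1 (by decide)]
  intro j _ s₂ hj h₂
  simp [Test.Holds, entry, realItem, RealExpr.eval, NatExpr.eval, hj, exec,
    h₂.var 10 (by decide), hx, h₂.real 0 (by decide), h₁.real 0 (by decide)]

open Classical in
theorem compare_spec (s : Store) :
    ((compareCode.exec s).var 21 = if ∃ j < s.var 1, s.real 0 (s.var 10) j = 0 ∧
      s.real 0 (s.var 11) j ≠ 0 then 1 else 0) ∧
    ((compareCode.exec s).var 22 = if ∃ j < s.var 1, s.real 0 (s.var 11) j = 0 ∧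
      s.real 0 (s.var 10) j ≠ 0 then 1 else 0) := by
  rw [compareCode, exec]
  constructor
  · rw [(sameOff_exec _ _).var 21 (by decide), existsFor_spec rfl (by decide)
      (P := fun j => s.real 0 (s.var 10) j = 0 ∧ s.real 0 (s.var 11) j ≠ 0), Fin.val_one]
    intro j _ s₂ hj h₂
    simp [Test.Holds, isZero, entry, RealExpr.eval, NatExpr.eval, hj, exec,
      h₂.var 10 (by decide), h₂.var 11 (by decide), h₂.real 0 (by decide)]
  · have h := sameOff_exec
      (existsFor 12 1 .skip (.and (isZero 0 10 12) (.not (isZero 0 11 12))) 21) s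
    generalize (existsFor 12 1 .skip (.and (isZero 0 10 12) (.not (isZero 0 11 12))) 21).exec s = s'
      at h ⊢
    rw [existsFor_spec rfl (by decide)
      (P := fun j => s.real 0 (s.var 11) j = 0 ∧ s.real 0 (s.var 10) j ≠ 0), Fin.val_one,
      h.var 1 (by decide)]
    intro j _ s₂ hj h₂
    simp [Test.Holds, isZero, entry, RealExpr.eval, NatExpr.eval, hj, exec,
      h₂.var 10 (by decide), h₂.var 11 (by decide), h₂.real 0 (by decide),
      h.var 10 (by decide), h.var 11 (by decide), h.real 0 (by decide)]

open Classical in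
theorem facet_spec (s : Store) {N : ℕ → Prop} [DecidablePred N]
    (hN : ∀ i < s.var 0, s.nat 0 i 0 = if N i then 1 else 0) :
    ∀ i < s.var 0, (facetCode.exec s).nat 1 i 0 =
      if N i ∧ ¬ ∃ k < s.var 0, N k ∧ (¬ ∃ j < s.var 1, s.real 0 i j = 0 ∧ s.real 0 k j ≠ 0) ∧
        ∃ j < s.var 1, s.real 0 k j = 0 ∧ s.real 0 i j ≠ 0 then 1 else 0 := by
  refine mapNat_spec (y := 0) ?_ ?_ ?_
  · rfl
  · decide
  intro i hi s₁ hx h₁ _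
  have hlarger := existsFor_spec (x := 11) (y := 0) (c := compareCode) (z := 23)
    (b := .and (.natEq (natItem 0 11) (.const 1))
      (.and (.natEq (.var 21) (.const 0)) (.natEq (.var 22) (.const 1)))) rfl (by decide) (s := s₁)
    (P := fun k => N k ∧ (¬ ∃ j < s.var 1, s.real 0 i j = 0 ∧ s.real 0 k j ≠ 0) ∧
        ∃ j < s.var 1, s.real 0 k j = 0 ∧ s.real 0 i j ≠ 0) ?_
  · simp only [NatExpr.eval, natItem]
    rw [largerCode, hlarger, (sameOff_exec _ s₁).nat 0 (by decide),
      (sameOff_exec _ s₁).var 10 (by decide), hx, h₁.nat 0 (by decide), hN i hi, Fin.val_zero,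
      h₁.var 0 (by decide)]
    by_cases hNi : N i <;> simp only [hNi, true_and, false_and, if_true, if_false] <;>
      split_ifs <;> rfl
  · intro k hk s₂ hk' h₂
    rw [Fin.val_zero, h₁.var 0 (by decide)] at hk
    obtain ⟨h21, h22⟩ := compare_spec s₂
    simp only [Test.Holds, natItem, NatExpr.eval, h21, h22, (sameOff_exec compareCode s₂).nat 0 (by decide),
      (sameOff_exec compareCode s₂).var 11 (by decide), hk', h₂.var 10 (by decide), hx,
      h₂.nat 0 (by decide), h₁.nat 0 (by decide), h₂.real 0 (by decide), h₁.real 0 (by decide),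
      h₂.var 1 (by decide), h₁.var 1 (by decide), hN k hk]
    simp

open Classical in
theorem guard_spec (b : Test) (e : RealExpr) (s : Store) :
    ((guardCode b e).exec s).real 7 0 0 = if b.Holds s then e.eval s else 0 := by
  rw [guardCode, exec]
  split_ifs <;> simp [exec, Store.setReal_real, NatExpr.eval, RealExpr.eval]

theorem diff_spec (s : Store) : ∀ i < s.var 0, ∀ j < s.var 1, (diffCode.exec s).real 3 i j =
    if s.nat 1 i 0 = 1 then s.real 0 i j - s.real 0 i 0 else 0 := by
  refine mapReal₂_spec (y := 0) (y' := 1) ?_ ?_ ?_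
  · rfl
  · decide
  intro i hi j hj s₁ hx hx' h₁ _
  simp only [RealExpr.eval, NatExpr.eval, guard_spec, Test.Holds, natItem, entry, realItem, hx, hx',
    h₁.nat 1 (by decide), h₁.real 0 (by decide)]

theorem orth_spec (s : Store) : ∀ i < s.var 0, (orthCode.exec s).real 5 i 0 =
    s.real 3 i (s.var 13) - ∑ k ∈ Finset.range (s.var 0), s.real 4 i k * s.real 3 k (s.var 13) := by
  refine mapReal_spec (y := 0) ?_ ?_ ?_
  · rfl
  · decide
  intro i hi s₁ hx h₁
  simp only [RealExpr.eval, NatExpr.eval, entry]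
  rw [sumFor_spec rfl (V := fun k => s.real 4 i k * s.real 3 k (s.var 13)), Fin.val_zero,
    h₁.var 0 (by decide), (sameOff_exec _ s₁).real 3 (by decide),
    (sameOff_exec _ s₁).var 10 (by decide), (sameOff_exec _ s₁).var 13 (by decide), hx,
    h₁.real 3 (by decide), h₁.var 13 (by decide)]
  intro k _ s₂ hk h₂
  simp [RealExpr.eval, NatExpr.eval, hk, h₂.var 10 (by decide), h₂.var 13 (by decide), hx,
    h₂.real 3 (by decide), h₂.real 4 (by decide), h₁.var 13 (by decide), h₁.real 3 (by decide),
    h₁.real 4 (by decide)]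

theorem update_spec (s : Store) : ∀ i < s.var 0, ∀ k < s.var 0, (updateCode.exec s).real 4 i k =
    s.real 4 i k + s.real 5 i 0 * s.real 5 k 0 /
      ∑ l ∈ Finset.range (s.var 0), s.real 5 l 0 * s.real 5 l 0 := by
  have hsum := sumFor_spec (x := 10) (y := 0) (a := 6) (e := .mul (realItem 5 10) (realItem 5 10))
    rfl (s := s) (V := fun l => s.real 5 l 0 * s.real 5 l 0) (fun l _ s₁ hl h₁ => by
      simp [RealExpr.eval, NatExpr.eval, realItem, hl, h₁.real 5 (by decide)])
  have h := sameOff_exec (sumFor 10 0 6 (.mul (realItem 5 10) (realItem 5 10))) s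
  have hmap := mapReal₂_spec (x := 10) (y := 0) (x' := 12) (y' := 0) (c := .skip) (a := 4)
    (e := .add (entry 4 10 12)
      (.div (.mul (realItem 5 10) (realItem 5 12)) (.get 6 (.const 0) (.const 0)))) rfl (by decide)
    (s := (sumFor 10 0 6 (.mul (realItem 5 10) (realItem 5 10))).exec s)
    (V := fun i k => s.real 4 i k + s.real 5 i 0 * s.real 5 k 0 /
      ∑ l ∈ Finset.range (s.var 0), s.real 5 l 0 * s.real 5 l 0) ?_
  · rwa [Fin.val_zero, h.var 0 (by decide)] at hmap
  · intro i _ k _ s₁ hi hk h₁ h4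
    have h5 := h₁.real 5 (by decide)
    have h6 := h₁.real 6 (by decide)
    rw [h.real 5 (by decide)] at h5
    rw [h.real 4 (by decide)] at h4
    simp only [exec, RealExpr.eval, NatExpr.eval, entry, realItem, hi, hk, h4, h5, h6]
    simp only [realItem] at hsum
    rw [hsum, Fin.val_zero]

/-- The columns of the array `a`. -/
def column (s : Store) (a m j : ℕ) : Fin m → ℝ := fun i => s.real a i j

theorem proj_spec (s : Store) (h4 : ∀ i j, s.real 4 i j = 0) :
    IsProjectionMatrix ((projCode.exec s).matrix 4 (s.var 0) (s.var 0))
      (Submodule.span ℝ (column s 3 (s.var 0) '' Set.Iio (s.var 1))) := by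
  refine exec_forTo (x := 13) (y := 1) (c := .seq orthCode updateCode) rfl (s := s)
    (fun k s' => IsProjectionMatrix (s'.matrix 4 (s.var 0) (s.var 0))
      (Submodule.span ℝ (column s 3 (s.var 0) '' Set.Iio k))) ?_ ?_
  -- The array is initially zero, and the zero matrix is the projection onto the span of no columns.
  · refine ⟨fun i j => ?_, fun c hc => ?_, fun j => ?_⟩
    · simp [Store.matrix, h4]
    · have : c = 0 := by simpa using hc
      rw [this, Matrix.mulVec_zero]
    · have : (fun i => ((s.setVar 13 0).matrix 4 (s.var 0) (s.var 0)) i j) = 0 :=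
        funext fun i => h4 i j
      rw [this]
      exact Submodule.zero_mem _
  · intro k _ s₁ hk h₁ hI
    have hset : Set.Iio (k + 1) = insert k (Set.Iio k) := by ext; simp
    have h₂ := sameOff_exec orthCode s₁
    rw [hset, Set.image_insert_eq, Submodule.span_insert, sup_comm]
    have hw : (fun i : Fin (s.var 0) => (orthCode.exec s₁).real 5 i 0) =
        column s 3 (s.var 0) k - (s₁.matrix 4 (s.var 0) (s.var 0)).mulVec
          (column s 3 (s.var 0) k) := by
      ext i
      rw [orth_spec s₁ i (by rw [h₁.var 0 (by decide)]; exact i.2), hk, h₁.real 3 (by decide),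
        h₁.var 0 (by decide)]
      simp only [Pi.sub_apply, Matrix.mulVec, dotProduct, column, Store.matrix]
      rw [Finset.sum_range]
    convert hI.sup_span hw using 1
    ext i j
    rw [Store.matrix, Store.setVar_real, exec, update_spec _ i
      (by rw [h₂.var 0 (by decide), h₁.var 0 (by decide)]; exact i.2) j
      (by rw [h₂.var 0 (by decide), h₁.var 0 (by decide)]; exact j.2),
      h₂.real 4 (by decide), h₂.var 0 (by decide), h₁.var 0 (by decide), Finset.sum_range]
    rfl

theorem init_spec (s : Store) : ∀ i < s.var 0, (initCode.exec s).nat 2 i 0 = i :=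
  mapNat_spec (x := 10) (y := 0) (c := .skip) (a := 2) (e := .var 10) (V := id) rfl (by decide)
    fun i _ s₁ hx _ _ => by simp [exec, NatExpr.eval, hx]

theorem join_spec (s : Store) : ∀ k < s.var 0, (joinCode.exec s).nat 2 k 0 =
    if s.nat 2 k 0 = s.nat 2 (s.var 10) 0 then s.nat 2 (s.var 11) 0 else s.nat 2 k 0 := by
  rw [joinCode, exec, exec]
  refine mapNat_spec (y := 0) (s := (setVar 25 (natItem 2 11)).exec
    ((setVar 24 (natItem 2 10)).exec s)) ?_ ?_ ?_
  · rfl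
  · decide
  intro k hk s₁ hx h₁ h2
  have h24 := h₁.var 24 (by decide)
  have h25 := h₁.var 25 (by decide)
  simp only [exec, natItem, NatExpr.eval, Store.setVar_var, Store.setVar_nat] at h24 h25 h2
  simp only [exec, Test.Holds, natItem, NatExpr.eval, hx, h2]
  simp at h24 h25
  split_ifs <;> simp_all [Store.setVar_var]

/-- Rows with different components are not adjacent, and components are not cut by sets that are
closed under adjacency. -/
theorem comp_spec (s : Store) (hc : ∀ i < s.var 0, s.nat 2 i 0 = i) :
    (∀ i < s.var 0, ∀ j < s.var 0, s.real 4 i j ≠ 0 →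
      (compCode.exec s).nat 2 i 0 = (compCode.exec s).nat 2 j 0) ∧
    ∀ X : Set ℕ, (∀ i < s.var 0, ∀ j < s.var 0, s.real 4 i j ≠ 0 → (i ∈ X ↔ j ∈ X)) →
      ∀ i < s.var 0, ∀ j < s.var 0,
        (compCode.exec s).nat 2 i 0 = (compCode.exec s).nat 2 j 0 → (i ∈ X ↔ j ∈ X) := by
  have key := exec_forTo (x := 10) (y := 0) (c := .forTo 11 0
    (.ite (.not (isZero 4 10 11)) joinCode .skip)) rfl (s := s)
    (fun k s' => (∀ i < s.var 0, ∀ j < s.var 0, i < k → s.real 4 i j ≠ 0 →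
      s'.nat 2 i 0 = s'.nat 2 j 0) ∧
      ∀ X : Set ℕ, (∀ i < s.var 0, ∀ j < s.var 0, s.real 4 i j ≠ 0 → (i ∈ X ↔ j ∈ X)) →
        ∀ i < s.var 0, ∀ j < s.var 0, s'.nat 2 i 0 = s'.nat 2 j 0 → (i ∈ X ↔ j ∈ X)) ?_ ?_
  · exact ⟨fun i hi j hj => key.1 i hi j hj hi, key.2⟩
  · refine ⟨fun i _ j _ h => absurd h (by omega), fun X _ i hi j hj h => ?_⟩
    rw [Store.setVar_nat, hc i hi, hc j hj] at h
    rw [h]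
  · intro k hk s₁ hxk h₁ hI
    have hm := h₁.var 0 (by decide)
    have hinner := exec_forTo (x := 11) (y := 0) (c := .ite (.not (isZero 4 10 11)) joinCode .skip)
      rfl (s := s₁)
      (fun l s' => (∀ i < s.var 0, ∀ j < s.var 0, i < k ∨ i = k ∧ j < l → s.real 4 i j ≠ 0 →
        s'.nat 2 i 0 = s'.nat 2 j 0) ∧
        ∀ X : Set ℕ, (∀ i < s.var 0, ∀ j < s.var 0, s.real 4 i j ≠ 0 → (i ∈ X ↔ j ∈ X)) →
          ∀ i < s.var 0, ∀ j < s.var 0, s'.nat 2 i 0 = s'.nat 2 j 0 → (i ∈ X ↔ j ∈ X))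
      ⟨fun i hi j hj h => hI.1 i hi j hj (by omega), hI.2⟩ ?_
    · rw [Fin.val_zero, hm] at hinner
      exact ⟨fun i hi j hj h => hinner.1 i hi j hj (by omega), hinner.2⟩
    · intro l hl s₂ hxl h₂ hI₂
      rw [Fin.val_zero, hm] at hl
      have hm₂ : s₂.var 0 = s.var 0 := (h₂.var 0 (by decide)).trans hm
      have h10 : s₂.var 10 = k := (h₂.var 10 (by decide)).trans hxk
      have hb : (Test.not (isZero 4 10 11)).Holds s₂ ↔ s.real 4 k l ≠ 0 := by
        simp [Test.Holds, isZero, entry, RealExpr.eval, NatExpr.eval, h10, hxl,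
          h₂.real 4 (by decide), h₁.real 4 (by decide)]
      rw [Store.setVar_nat, exec]
      by_cases hkl : s.real 4 k l ≠ 0
      · rw [if_pos (hb.2 hkl)]
        have hj := join_spec s₂
        rw [hm₂, h10, hxl] at hj
        refine ⟨fun i hi j hj' h hij => ?_, fun X hX i hi j hj' h => ?_⟩
        · rw [hj i hi, hj j hj']
          -- The current pair ends with the label of `l` on both sides; earlier pairs keep equal
          -- labels because relabelling depends only on the old label.
          by_cases hnew : i = k ∧ j = l
          · rw [hnew.1, hnew.2]
            simp
          · rw [hI₂.1 i hi j hj' (by omega) hij]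
        · have hI' := hI₂.2 X hX
          have hXkl := hX k hk l hl hkl
          rw [hj i hi, hj j hj'] at h
          -- If exactly one of the two rows is relabelled, equality of the new labels leads from one
          -- row to the other through the edge between `k` and `l`, which `X` does not cut.
          split_ifs at h with hi' hj'' hj''
          · exact hI' i hi j hj' (hi'.trans hj''.symm)
          · exact (hI' i hi k hk hi').trans (hXkl.trans (hI' l hl j hj' h))
          · exact (hI' i hi l hl h).trans (hXkl.symm.trans (hI' k hk j hj' hj''.symm))
          · exact hI' i hi j hj' h
      · rw [if_neg (mt hb.1 hkl), exec]
        refine ⟨fun i hi j hj h hij => ?_, hI₂.2⟩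
        by_cases hnew : i = k ∧ j = l
        · exact absurd (hnew.1 ▸ hnew.2 ▸ hij) hkl
        · exact hI₂.1 i hi j hj (by omega) hij

/-- Each facet row overwrites the choice, so the last one wins. Without facet rows the choice is
irrelevant, because only facet rows are tested against it later. -/
theorem pick_spec (s : Store) (hf : ∃ i < s.var 0, s.nat 1 i 0 = 1) :
    ∃ i < s.var 0, s.nat 1 i 0 = 1 ∧ (pickCode.exec s).var 27 = s.nat 2 i 0 := by
  refine exec_forTo (x := 10) (y := 0) rfl (s := s) (fun k s' => (∃ i < k, s.nat 1 i 0 = 1) →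
    ∃ i < k, s.nat 1 i 0 = 1 ∧ s'.var 27 = s.nat 2 i 0) (by simp) ?_ hf
  intro k _ s₁ hk h₁ hI hex
  have hb : (Test.natEq (natItem 1 10) (.const 1)).Holds s₁ ↔ s.nat 1 k 0 = 1 := by
    simp [Test.Holds, natItem, NatExpr.eval, hk, h₁.nat 1 (by decide)]
  rw [exec]
  by_cases hk1 : s.nat 1 k 0 = 1
  · refine ⟨k, by omega, hk1, ?_⟩
    rw [if_pos (hb.2 hk1)]
    simp [exec, natItem, NatExpr.eval, Store.setVar_var, hk, h₁.nat 2 (by decide)]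
  · rw [if_neg (mt hb.1 hk1), exec, Store.setVar_var, if_neg (by decide)]
    obtain ⟨i, hi, hi1⟩ := hex
    obtain ⟨i', hi', h'⟩ := hI ⟨i, by
      rcases Nat.lt_succ_iff_lt_or_eq.1 hi with h | rfl
      exacts [h, absurd hi1 hk1], hi1⟩
    exact ⟨i', by omega, h'⟩

open Classical in
theorem answer_spec (s : Store) : (answerCode.exec s).var 28 =
    if ∃ i < s.var 0, s.nat 1 i 0 = 1 ∧ s.nat 2 i 0 ≠ s.var 27 then 1 else 0 := by
  rw [answerCode, existsFor_spec rfl (by decide)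
    (P := fun i => s.nat 1 i 0 = 1 ∧ s.nat 2 i 0 ≠ s.var 27), Fin.val_zero]
  intro i _ s₁ hi h₁
  simp [outsideTest, Test.Holds, natItem, NatExpr.eval, exec, hi, h₁.nat 1 (by decide),
    h₁.nat 2 (by decide), h₁.var 27 (by decide)]

theorem copy_inside_spec (s : Store) : ∀ i < s.var 0, ∀ j < s.var 1,
    ((copyCode insideTest 1).exec s).real 1 i j =
      if s.nat 1 i 0 = 1 ∧ s.nat 2 i 0 = s.var 27 then s.real 0 i j else 0 := by
  refine mapReal₂_spec (y := 0) (y' := 1) ?_ ?_ ?_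
  · rfl
  · decide
  intro i hi j hj s₁ hx hx' h₁ _
  simp only [RealExpr.eval, NatExpr.eval, guard_spec, insideTest, Test.Holds, natItem, entry, hx,
    hx', h₁.nat 1 (by decide), h₁.nat 2 (by decide), h₁.var 27 (by decide), h₁.real 0 (by decide)]

theorem copy_outside_spec (s : Store) : ∀ i < s.var 0, ∀ j < s.var 1,
    ((copyCode outsideTest 2).exec s).real 2 i j =
      if s.nat 1 i 0 = 1 ∧ ¬ s.nat 2 i 0 = s.var 27 then s.real 0 i j else 0 := by
  refine mapReal₂_spec (y := 0) (y' := 1) ?_ ?_ ?_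
  · rfl
  · decide
  intro i hi j hj s₁ hx hx' h₁ _
  simp only [RealExpr.eval, NatExpr.eval, guard_spec, outsideTest, Test.Holds, natItem, entry, hx,
    hx', h₁.nat 1 (by decide), h₁.nat 2 (by decide), h₁.var 27 (by decide), h₁.real 0 (by decide)]

end Code

end RealRAM

namespace RealRAM

namespace Code

/-! ### Correctness of the algorithm -/

theorem input_real {m n : ℕ} (S : Matrix (Fin m) (Fin n) ℝ) (i : Fin m) (j : Fin n) :
    (Store.input S).real 0 i j = S i j := by
  simp [Store.input]

theorem exists_ne_iff_nonconstRow {m n : ℕ} (S : Matrix (Fin m) (Fin n) ℝ) (i : Fin m) :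
    (∃ j < n, (Store.input S).real 0 i j ≠ (Store.input S).real 0 i 0) ↔ NonconstRow S i := by
  constructor
  · rintro ⟨j, hj, hne⟩
    refine ⟨⟨j, hj⟩, ⟨0, by omega⟩, ?_⟩
    rwa [← input_real S, ← input_real S]
  · rintro ⟨j, j', hne⟩
    by_contra! h
    exact hne (by rw [← input_real S, ← input_real S, h j j.2, h j' j'.2])

theorem facetMark_iff {m n : ℕ} (S : Matrix (Fin m) (Fin n) ℝ) (i : Fin m) :
    ((∃ j < n, (Store.input S).real 0 i j ≠ (Store.input S).real 0 i 0) ∧ ¬ ∃ k < m,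
      (∃ j < n, (Store.input S).real 0 k j ≠ (Store.input S).real 0 k 0) ∧
        (¬ ∃ j < n, (Store.input S).real 0 i j = 0 ∧ (Store.input S).real 0 k j ≠ 0) ∧
          ∃ j < n, (Store.input S).real 0 k j = 0 ∧ (Store.input S).real 0 i j ≠ 0) ↔
      IsFacetRow S i := by
  rw [exists_ne_iff_nonconstRow]
  refine and_congr_right fun _ => ⟨fun h k hk ⟨h₁, j, h₂, h₃⟩ => h ⟨k, k.2, ?_, ?_, j, j.2, ?_⟩, ?_⟩
  · rwa [exists_ne_iff_nonconstRow]
  · rintro ⟨j, hj, h₄, h₅⟩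
    have h₆ := input_real S i ⟨j, hj⟩
    have h₇ := input_real S k ⟨j, hj⟩
    exact h₅ (h₇.trans (h₁ _ (h₆.symm.trans h₄)))
  · rw [input_real, input_real]
    exact ⟨h₂, h₃⟩
  · rintro h ⟨k, hk, h₁, h₂, j, hj, h₃, h₄⟩
    refine h ⟨k, hk⟩ ((exists_ne_iff_nonconstRow S ⟨k, hk⟩).1 h₁) ⟨fun l hl => ?_, ⟨j, hj⟩, ?_, ?_⟩
    · by_contra h₅
      exact h₂ ⟨l, l.2, by rwa [input_real], by rwa [← input_real S] at h₅⟩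
    · rw [← input_real S]
      exact h₃
    · rw [← input_real S]
      exact h₄

-- The direction of an affine hull is spanned by the differences from one base point, here the first
-- column. Without columns there is no base point, and both spaces are zero.
open Classical in
theorem span_eq_facetSpace {m n : ℕ} (S : Matrix (Fin m) (Fin n) ℝ) {D : ℕ → Fin m → ℝ}
    (hD : ∀ j < n, ∀ i, D j i = if IsFacetRow S i then
      (Store.input S).real 0 i j - (Store.input S).real 0 i 0 else 0) :
    Submodule.span ℝ (D '' Set.Iio n) = facetSpace S := by
  rcases n.eq_zero_or_pos with rfl | hn
  · simp [facetSpace, Set.range_eq_empty]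
  · rw [facetSpace, vectorSpan_range_eq_span_range_vsub_right ℝ _ (⟨0, hn⟩ : Fin n)]
    congr 1
    have hDj : ∀ j : Fin n, D j = maskedCol S {i | IsFacetRow S i} j -ᵥ
        maskedCol S {i | IsFacetRow S i} ⟨0, hn⟩ := fun j => by
      ext i
      rw [hD j j.2, input_real, show (Store.input S).real 0 i 0 = _ from input_real S i ⟨0, hn⟩]
      by_cases hi : IsFacetRow S i <;> simp [maskedCol, hi]
    ext c
    constructor
    · rintro ⟨j, hj, rfl⟩
      exact ⟨⟨j, hj⟩, (hDj ⟨j, hj⟩).symm⟩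
    · rintro ⟨j, rfl⟩
      exact ⟨j, j.2, hDj j⟩

open Classical in
/-- The algorithm computes the components `κ` of the support of the projection matrix, the component
`κ₀` of a facet row, the rows in that component, and those in the other components. -/
theorem main_spec {m n : ℕ} (S : Matrix (Fin m) (Fin n) ℝ) :
    ∃ (Q : Matrix (Fin m) (Fin m) ℝ) (κ : Fin m → ℕ) (κ₀ : ℕ),
      IsProjectionMatrix Q (facetSpace S) ∧
      (∀ i j, Q i j ≠ 0 → κ i = κ j) ∧
      (∀ X : Set (Fin m), (∀ i j, Q i j ≠ 0 → (i ∈ X ↔ j ∈ X)) →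
        ∀ i j, κ i = κ j → (i ∈ X ↔ j ∈ X)) ∧
      ((∃ i, IsFacetRow S i) → ∃ i, IsFacetRow S i ∧ κ i = κ₀) ∧
      ((mainCode.exec (Store.input S)).var 28 =
        if ∃ i, IsFacetRow S i ∧ κ i ≠ κ₀ then 1 else 0) ∧
      (mainCode.exec (Store.input S)).matrix 1 m n = facetRowsIn S {i | κ i = κ₀} ∧
      (mainCode.exec (Store.input S)).matrix 2 m n = facetRowsIn S {i | κ i = κ₀}ᶜ := by
  set s₀ := Store.input S with hs₀
  obtain ⟨s₁, h₁⟩ : ∃ s, s = nonconstCode.exec s₀ := ⟨_, rfl⟩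
  obtain ⟨s₂, h₂⟩ : ∃ s, s = facetCode.exec s₁ := ⟨_, rfl⟩
  obtain ⟨s₃, h₃⟩ : ∃ s, s = diffCode.exec s₂ := ⟨_, rfl⟩
  obtain ⟨s₄, h₄⟩ : ∃ s, s = projCode.exec s₃ := ⟨_, rfl⟩
  obtain ⟨s₅, h₅⟩ : ∃ s, s = initCode.exec s₄ := ⟨_, rfl⟩
  obtain ⟨s₆, h₆⟩ : ∃ s, s = compCode.exec s₅ := ⟨_, rfl⟩
  obtain ⟨s₇, h₇⟩ : ∃ s, s = pickCode.exec s₆ := ⟨_, rfl⟩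
  obtain ⟨s₈, h₈⟩ : ∃ s, s = answerCode.exec s₇ := ⟨_, rfl⟩
  obtain ⟨s₉, h₉⟩ : ∃ s, s = (copyCode insideTest 1).exec s₈ := ⟨_, rfl⟩
  obtain ⟨s₁₀, h₁₀⟩ : ∃ s, s = (copyCode outsideTest 2).exec s₉ := ⟨_, rfl⟩
  have hmain : mainCode.exec s₀ = s₁₀ := by subst_vars; rfl
  have f₁ : SameOff _ s₀ s₁ := h₁ ▸ sameOff_exec _ _
  have f₂ : SameOff _ s₁ s₂ := h₂ ▸ sameOff_exec _ _
  have f₃ : SameOff _ s₂ s₃ := h₃ ▸ sameOff_exec _ _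
  have f₄ : SameOff _ s₃ s₄ := h₄ ▸ sameOff_exec _ _
  have f₅ : SameOff _ s₄ s₅ := h₅ ▸ sameOff_exec _ _
  have f₆ : SameOff _ s₅ s₆ := h₆ ▸ sameOff_exec _ _
  have f₇ : SameOff _ s₆ s₇ := h₇ ▸ sameOff_exec _ _
  have f₈ : SameOff _ s₇ s₈ := h₈ ▸ sameOff_exec _ _
  have f₉ : SameOff _ s₈ s₉ := h₉ ▸ sameOff_exec _ _
  have f₁₀ : SameOff _ s₉ s₁₀ := h₁₀ ▸ sameOff_exec _ _
  have m₀ : s₀.var 0 = m := rfl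
  have n₀ : s₀.var 1 = n := rfl
  have m₁ : s₁.var 0 = m := (f₁.var 0 (by decide)).trans m₀
  have n₁ : s₁.var 1 = n := (f₁.var 1 (by decide)).trans n₀
  have m₂ : s₂.var 0 = m := (f₂.var 0 (by decide)).trans m₁
  have n₂ : s₂.var 1 = n := (f₂.var 1 (by decide)).trans n₁
  have m₃ : s₃.var 0 = m := (f₃.var 0 (by decide)).trans m₂
  have n₃ : s₃.var 1 = n := (f₃.var 1 (by decide)).trans n₂
  have m₄ : s₄.var 0 = m := (f₄.var 0 (by decide)).trans m₃
  have m₅ : s₅.var 0 = m := (f₅.var 0 (by decide)).trans m₄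
  have m₆ : s₆.var 0 = m := (f₆.var 0 (by decide)).trans m₅
  have m₇ : s₇.var 0 = m := (f₇.var 0 (by decide)).trans m₆
  have m₈ : s₈.var 0 = m := (f₈.var 0 (by decide)).trans m₇
  have m₉ : s₉.var 0 = m := (f₉.var 0 (by decide)).trans m₈
  have n₇ : s₇.var 1 = n := by
    rw [f₇.var 1 (by decide), f₆.var 1 (by decide), f₅.var 1 (by decide), f₄.var 1 (by decide), n₃]
  have n₈ : s₈.var 1 = n := (f₈.var 1 (by decide)).trans n₇
  have n₉ : s₉.var 1 = n := (f₉.var 1 (by decide)).trans n₈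
  -- the facet rows
  have hmark : ∀ i : Fin m, s₂.nat 1 i 0 = 1 ↔ IsFacetRow S i := fun i => by
    have hN := nonconst_spec s₀
    rw [← h₁, ← f₁.var 0 (by decide)] at hN
    have h := facet_spec s₁ hN i (by rw [m₁]; exact i.2)
    rw [← h₂, m₁, n₁, n₀, f₁.real 0 (by decide)] at h
    rw [h, ← facetMark_iff]
    split_ifs with hif
    · exact ⟨fun _ => hif, fun _ => rfl⟩
    · exact ⟨fun h0 => absurd h0 (by decide), fun h0 => absurd h0 hif⟩
  -- the projection matrix
  have hproj : IsProjectionMatrix (s₄.matrix 4 m m) (facetSpace S) := by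
    have hzero : ∀ i j, s₃.real 4 i j = 0 := fun i j => by
      rw [f₃.real 4 (by decide), f₂.real 4 (by decide), f₁.real 4 (by decide)]
      simp [hs₀, Store.input]
    have h := proj_spec s₃ hzero
    rw [← h₄, m₃, n₃] at h
    rwa [← span_eq_facetSpace S (D := column s₃ 3 m)]
    intro j hj i
    have hd := diff_spec s₂ i (by rw [m₂]; exact i.2) j (by rwa [n₂])
    rw [← h₃, f₂.real 0 (by decide), f₁.real 0 (by decide)] at hd
    rw [column, hd]
    exact if_congr (hmark i) rfl rfl
  -- the components
  have hinit := init_spec s₄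
  rw [← h₅, ← f₅.var 0 (by decide)] at hinit
  obtain ⟨hedge, hcut⟩ := comp_spec s₅ hinit
  rw [← h₆, m₅, f₅.real 4 (by decide)] at hedge hcut
  have hmark₆ : s₆.nat 1 = s₂.nat 1 := by
    rw [f₆.nat 1 (by decide), f₅.nat 1 (by decide), f₄.nat 1 (by decide), f₃.nat 1 (by decide)]
  have hpick := pick_spec s₆
  rw [← h₇, m₆, hmark₆] at hpick
  have hmark₇ : s₇.nat 1 = s₂.nat 1 := (f₇.nat 1 (by decide)).trans hmark₆
  have hcomp₇ : s₇.nat 2 = s₆.nat 2 := f₇.nat 2 (by decide)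
  have hans := answer_spec s₇
  rw [← h₈, hmark₇, hcomp₇, m₇] at hans
  have hreal₈ : s₈.real 0 = s₀.real 0 := by
    rw [f₈.real 0 (by decide), f₇.real 0 (by decide), f₆.real 0 (by decide), f₅.real 0 (by decide),
      f₄.real 0 (by decide), f₃.real 0 (by decide), f₂.real 0 (by decide), f₁.real 0 (by decide)]
  have hin := copy_inside_spec s₈
  rw [← h₉, m₈, n₈, f₈.nat 1 (by decide), f₈.nat 2 (by decide), f₈.var 27 (by decide), hmark₇,
    hcomp₇, hreal₈] at hin
  have hout := copy_outside_spec s₉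
  rw [← h₁₀, m₉, n₉, f₉.nat 1 (by decide), f₉.nat 2 (by decide), f₉.var 27 (by decide),
    f₉.real 0 (by decide), f₈.nat 1 (by decide), f₈.nat 2 (by decide), f₈.var 27 (by decide),
    hmark₇, hcomp₇, hreal₈] at hout
  rw [hmain]
  refine ⟨s₄.matrix 4 m m, fun i => s₆.nat 2 i 0, s₇.var 27, hproj,
    fun i j h => hedge i i.2 j j.2 h, fun X hX i j hij => ?_, fun ⟨i, hi⟩ => ?_, ?_, ?_, ?_⟩
  · have := hcut {k | ∃ h : k < m, (⟨k, h⟩ : Fin m) ∈ X} (fun i hi j hj hij => by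
      simpa [hi, hj] using hX ⟨i, hi⟩ ⟨j, hj⟩ hij) i i.2 j j.2 hij
    simpa using this
  · obtain ⟨k, hk, hk₁, hk₂⟩ := hpick ⟨i, i.2, (hmark i).2 hi⟩
    exact ⟨⟨k, hk⟩, (hmark ⟨k, hk⟩).1 hk₁, hk₂.symm⟩
  · rw [f₁₀.var 28 (by decide), f₉.var 28 (by decide), hans]
    refine if_congr ⟨?_, ?_⟩ rfl rfl
    · rintro ⟨i, hi, h, h'⟩
      exact ⟨⟨i, hi⟩, (hmark ⟨i, hi⟩).1 h, h'⟩
    · rintro ⟨i, h, h'⟩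
      exact ⟨i, i.2, (hmark i).2 h, h'⟩
  · ext i j
    rw [Store.matrix, f₁₀.real 1 (by decide), hin i i.2 j j.2, hs₀, input_real]
    simp only [facetRowsIn, maskedCol, Matrix.of_apply, Set.indicator_apply, Set.mem_ofPred_eq,
      hmark i]
    by_cases hi : IsFacetRow S i <;> by_cases hκ : s₆.nat 2 i 0 = s₇.var 27 <;>
      simp only [hi, hκ, and_self, and_true, and_false, if_true, if_false]
  · ext i j
    rw [Store.matrix, hout i i.2 j j.2, hs₀, input_real]
    simp only [facetRowsIn, maskedCol, Matrix.of_apply, Set.indicator_apply, Set.mem_ofPred_eq,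
      Set.mem_compl_iff, hmark i]
    by_cases hi : IsFacetRow S i <;> by_cases hκ : s₆.nat 2 i 0 = s₇.var 27 <;>
      simp only [hi, hκ, and_self, and_true, and_false, not_true, not_false_iff, if_true, if_false]

end Code

/-! ### Output and the decision theorem -/

/-- Move the answer and the formats of the output matrices to their places. -/
def Program.output : Program :=
  -- The order matters: the number of columns is copied before variable `1` is overwritten, and the
  -- number of rows before variable `0` receives the answer.
  .seq (.setVar 2 (.var 1)) (.seq (.setVar 4 (.var 1)) (.seq (.setVar 3 (.var 0))
    (.seq (.setVar 1 (.var 0)) (.setVar 0 (.var 28)))))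

theorem Program.runs_output (s : Store) :
    ∃ s' t, Runs Program.output s s' t ∧ t = 10 ∧ s'.var 0 = s.var 28 ∧ s'.var 1 = s.var 0 ∧
      s'.var 2 = s.var 1 ∧ s'.var 3 = s.var 0 ∧ s'.var 4 = s.var 1 ∧ s'.real = s.real :=
  ⟨_, _, .seq (.setVar _ _ _) (.seq (.setVar _ _ _) (.seq (.setVar _ _ _)
    (.seq (.setVar _ _ _) (.setVar _ _ _)))), rfl, rfl, rfl, rfl, rfl, rfl, rfl⟩

end RealRAM

-- A component of the support graph is a separator. If facet rows lie both inside and outside the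
-- picked one, it splits `P`; if all facet rows share one component, no separator can divide them.
-- The output matrices keep the full format, with zero rows in place of the omitted ones; a zero row
-- is a trivial inequality.
open RealRAM in
theorem IsSlackMatrix.exists_runs {m n d : ℕ} {S : Matrix (Fin m) (Fin n) ℝ}
    {P : Set (Fin d → ℝ)} (h : IsSlackMatrix S P) :
    ∃ (s : Store) (t : ℕ),
      Runs (.seq Code.mainCode.toProgram .output) (Store.input S) s t ∧
      t ≤ MvPolynomial.eval ![m, n] Code.mainCode.bound + 10 ∧
      ((s.answer = 1 ∧ s.outputSize = m * n + m * n ∧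
          ∃ (d₁ d₂ : ℕ) (P₁ : Set (Fin d₁ → ℝ)) (P₂ : Set (Fin d₂ → ℝ)),
            IsProductOf P P₁ P₂ ∧ IsSlackMatrix s.output₁ P₁ ∧ IsSlackMatrix s.output₂ P₂) ∨
        (s.answer = 0 ∧
          ¬ ∃ (d₁ d₂ : ℕ) (P₁ : Set (Fin d₁ → ℝ)) (P₂ : Set (Fin d₂ → ℝ)),
            IsProductOf P P₁ P₂)) := by
  classical
  obtain ⟨t, hrun, ht⟩ := Code.runs_exec (c := Code.mainCode) (by decide) (Store.input S)
  obtain ⟨Q, κ, κ₀, hQ, hedge, hcut, hpick, hans, hout₁, hout₂⟩ := Code.main_spec S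
  have hm := Code.exec_format (c := Code.mainCode) (by decide) (Store.input S) 0
  have hn := Code.exec_format (c := Code.mainCode) (by decide) (Store.input S) 1
  rw [Fin.val_zero, show (Store.input S).var 0 = m from rfl] at hm
  rw [Fin.val_one, show (Store.input S).var 1 = n from rfl] at hn
  obtain ⟨s, t', hrun', rfl, h0, h1, h2, h3, h4, hreal⟩ :=
    Program.runs_output (Code.mainCode.exec (Store.input S))
  rw [hm] at h1 h3
  rw [hn] at h2 h4
  refine ⟨s, _, .seq hrun hrun', Nat.add_le_add_right ht 10, ?_⟩
  have hmat : ∀ a, s.matrix a m n = (Code.mainCode.exec (Store.input S)).matrix a m n :=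
    fun a => by
      ext i j
      exact congrFun (congrFun (congrFun hreal a) i) j
  rw [hans] at h0
  have hsep : IsSeparator S {i | κ i = κ₀} := hQ.isSeparator_iff.2 fun i hi j hj => by
    by_contra hne
    exact hj ((hedge i j hne).symm.trans hi)
  by_cases hex : ∃ i, IsFacetRow S i ∧ κ i ≠ κ₀
  · rw [if_pos hex] at h0
    obtain ⟨i, hi, hiκ⟩ := hex
    obtain ⟨i', hi', hiκ'⟩ := hpick ⟨i, hi⟩
    obtain ⟨d₁, d₂, P₁, P₂, hP, hS₁, hS₂⟩ := h.exists_isProductOf hsep ⟨i', hiκ', hi'⟩ ⟨i, hiκ, hi⟩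
    refine .inl ⟨h0, by rw [Store.outputSize, h1, h2, h3, h4], d₁, d₂, P₁, P₂, hP, ?_, ?_⟩
    · rwa [Store.output₁, h1, h2, hmat, hout₁]
    · rwa [Store.output₂, h3, h4, hmat, hout₂]
  · rw [if_neg hex] at h0
    refine .inr ⟨h0, fun hP => ?_⟩
    obtain ⟨X, hX, ⟨i, hiX, hi⟩, j, hjX, hj⟩ := h.exists_separator hP
    push Not at hex
    have hX' := hQ.isSeparator_iff.1 hX
    -- No nonzero entry of `Q` crosses the border of the separator `X`, so `X` is a union of
    -- components and cannot divide the single component that holds all facet rows.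
    refine hjX ((hcut X (fun i j hne => ?_) i j ((hex i hi).trans (hex j hj).symm)).1 hiX)
    constructor
    · intro hiX
      by_contra hjX
      exact hne (hX' i hiX j hjX)
    · intro hjX
      by_contra hiX
      exact hne ((hQ.symm i j).trans (hX' j hjX i hiX))

theorem theorem2 :
    ∃ (c : RealRAM.Program) (p : MvPolynomial (Fin 2) ℕ),
      ∀ (m n d : ℕ) (S : Matrix (Fin m) (Fin n) ℝ) (P : Set (Fin d → ℝ)),
        IsSlackMatrix S P →
        ∃ (s : RealRAM.Store) (t : ℕ),
          RealRAM.Runs c (RealRAM.Store.input S) s t ∧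
          t ≤ MvPolynomial.eval ![m, n] p ∧
          ((s.answer = 1 ∧
              s.outputSize ≤ MvPolynomial.eval ![m, n] p ∧
              ∃ (d₁ d₂ : ℕ) (P₁ : Set (Fin d₁ → ℝ)) (P₂ : Set (Fin d₂ → ℝ)),
                IsProductOf P P₁ P₂ ∧
                IsSlackMatrix s.output₁ P₁ ∧ IsSlackMatrix s.output₂ P₂) ∨
            (s.answer = 0 ∧
              ¬ ∃ (d₁ d₂ : ℕ) (P₁ : Set (Fin d₁ → ℝ)) (P₂ : Set (Fin d₂ → ℝ)),
                IsProductOf P P₁ P₂)) := by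
  -- The `10` pays for the five final assignments of two steps each; the last summand covers the
  -- entries of two `m × n` output matrices.
  refine ⟨.seq RealRAM.Code.mainCode.toProgram .output, RealRAM.Code.mainCode.bound + 10 +
    2 * MvPolynomial.X 0 * MvPolynomial.X 1, fun m n d S P h => ?_⟩
  obtain ⟨s, t, hrun, ht, hs⟩ := h.exists_runs
  have hp : MvPolynomial.eval ![m, n] (RealRAM.Code.mainCode.bound + 10 +
      2 * MvPolynomial.X 0 * MvPolynomial.X 1) =
      MvPolynomial.eval ![m, n] RealRAM.Code.mainCode.bound + 10 + 2 * m * n := by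
    simp
  rw [hp]
  refine ⟨s, t, hrun, by omega, hs.imp_left fun ⟨ha, hsize, hprod⟩ => ⟨ha, ?_, hprod⟩⟩
  rw [hsize, mul_assoc]
  omega
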